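/- **Setting.** Let $n\ge 0$, $d\ge 1$ be integers. In each period $t=1,2,\dots$ a request $e_t\in\{0,1\}^n$ arrives (resource $i$ is eligible iff $e_t(i)=1$) and an action $a_t\in\{0,1,\dots,n\}$ is chosen. The request is fulfilled, with reward $R_t=1$, iff $a_t>0$, $e_t(a_t)=1$ and resource $a_t$ is available; the resource is then unavailable for the next $d-1$ periods and available again from period $t+d$ on. Otherwise $R_t=0$. All resources are available at the start. A sequence of requests has finite support if $e_t\ne 0$ for only finitely many $t$. $\mathrm{Opt}(e_{1:\infty})$ is the maximum of $\sum_t R_t$ over action sequences; for a finite request list and a system reached by a past trajectory $\mathcal I$, $\mathrm{Val}(\mathcal I,\cdot)$ and $\mathrm{Opt}(\mathcal I,\cdot)$ are the total reward of an action list and its maximum. For a randomized online algorithm, $\mathrm{Comp}$ is its expected total reward divided by $\mathrm{Opt}(e_{1:\infty})$. **Online oracle.** Periodic Re-Ranking (PRR) draws a fresh uniformly random order of the resources at its start and every $d$ periods thereafter, and gives each request to the available eligible resource of smallest rank, if any. Let $\eta^{\mathrm{ORRA}}$ be its competitive ratio: the infimum of $\mathrm{Comp}$ over all $n$, all $d\ge1$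 and all finite-support request sequences with $\mathrm{Opt}>0$. PRR$^*$ is the family of policies $\pi_0,\pi_1,\dots$: $\pi_0$ is PRR, and $\pi_m$ ($m\ge1$), used after $m$ elapsed periods, assigns nothing in periods $m+1,\dots,m+d-1$ and runs PRR from period $m+d$ on. **Offline oracle.** A $\gamma$-offline oracle returns, for every past trajectory $\mathcal I$ and every nonempty finite list of requests, an action list of the same length whose reward is at least $\gamma\,\mathrm{Opt}(\mathcal I,\cdot)$. **AdaSwitch-ORRA.** Inputs: a prediction $e^*_{1:\infty}$, a $\gamma$-offline oracle, real parameters $\eta,\epsilon,\alpha$, an integer $H$; put $c=d$, $b=2$. It starts in the conservative state with $\tau=1$. In period $t$: * *Conservative state.* Choose $a_t$ by the policy $\pi_{\tau-1}$ of PRR$^*$. Independently simulate $H t^5$ runs of $\pi_{\tau-1}$ on $e_\tau,\dots,e_t$ from the system at the start of period $\tau$, and let $s$ be the mean of their total rewards. If $s\ge\frac{16\eta}{\epsilon}\alpha c$, switch to the predictive state with $\tau_p=t+1$, $\varphi=0$. * *Predictive state.* If $t=\tau_p$, start a new batch: as long as $\tau_p\le\max\{t,\max\{j:e^*_j\ne0\}\}$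 and the plan $a_{t:\tau_p-1}$ (empty at first) has reward less than $\alpha c$ on $e_t,e^*_{t+1},\dots,e^*_{\tau_p-1}$, let the offline oracle compute a plan $a_{t:\tau_p}$ for $e_t,e^*_{t+1},\dots,e^*_{\tau_p}$ and increase $\tau_p$ by $1$. If the final plan has reward less than $\alpha c$, set $\tau_p=\infty$ and let the plan be arbitrary. Execute the planned $a_t$ and add $\min(\mathbb I(e_t\ne e^*_t),c/b)$ to $\varphi$. If $\varphi\ge\frac{\gamma\alpha}{(\eta-\frac{15}{16}\epsilon)(\alpha+\gamma)}\cdot\frac{5\alpha c}{b}$, switch to the conservative state with $\tau=t+1$. **Theorem.** There is a universal constant $C>0$ such that the following holds. Let $\eta\le\eta^{\mathrm{ORRA}}$, $\gamma\in(0,1]$, $\epsilon\in(0,\eta)$ and $\alpha\ge3$ with $\frac{\gamma\alpha}{\alpha+\gamma}\ge\eta-\frac{15\epsilon}{16}$, let $H\ge C\,\eta\alpha d/\epsilon^2$, and use any $\gamma$-offline oracle. For all finite-support sequences $e_{1:\infty}$ and $e^*_{1:\infty}$ with $\mathrm{Opt}(e_{1:\infty})>0$, and with $\varphi^*=\sum_{t\ge1}\mathbb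 I(e_t\neq e^*_t)$, the competitive ratio of AdaSwitch-ORRA on $e_{1:\infty}$ with prediction $e^*_{1:\infty}$ is at least $$\max\left\{\eta-\epsilon,\ \gamma-\frac{\gamma^2}{\alpha}-\frac{18\alpha d+14\eta\varphi^*\gamma^{-1}}{\epsilon\cdot\mathrm{Opt}(e_{1:\infty})}\right\}.$$ -/

import Mathlib

open scoped ENNReal

noncomputable section

namespace ORRA

/-! ### The allocation problem

Periods are indexed from `0`: index `t` stands for the `(t + 1)`-st period, so `t` is also the number
of periods that have elapsed before it. -/

/-- A request is a vector in `{0,1}^n`; `e i = true` means that resource `i` is eligible. -/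
abbrev Request (n : ℕ) : Type := Fin n → Bool

/-- The request for which no resource is eligible. -/
def emptyRequest (n : ℕ) : Request n := fun _ => false

/-- `some i` assigns resource `i`; `none` assigns nothing. -/
abbrev Action (n : ℕ) : Type := Option (Fin n)

/-- A trajectory of past requests and actions, in chronological order. -/
abbrev Trajectory (n : ℕ) : Type := List (Request n × Action n)

/-- The system before a period: the index of that period, and for each resource
the first period from which on it is available. -/
structure Sys (n : ℕ) where
  time : ℕ
  free : Fin n → ℕ

/-- Before the first period all resources are available. -/
def Sys.start (n : ℕ) : Sys n := ⟨0, fun _ => 0⟩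

/-- Resource `i` could serve request `e` now. -/
def Sys.CanServe {n : ℕ} (s : Sys n) (e : Request n) (i : Fin n) : Prop :=
  e i = true ∧ s.free i ≤ s.time

open Classical in
/-- Reward of action `a` on request `e`: `1` if the request is fulfilled, `0` otherwise. -/
def Sys.reward {n : ℕ} (s : Sys n) (e : Request n) (a : Action n) : ℕ :=
  if ∃ i, a = some i ∧ s.CanServe e i then 1 else 0

open Classical in
/-- A resource that fulfils a request in period `t` is available again from period `t + d` on. -/
def Sys.step {n : ℕ} (d : ℕ) (s : Sys n) (e : Request n) (a : Action n) : Sys n where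
  time := s.time + 1
  free := fun i => if a = some i ∧ s.CanServe e i then s.time + d else s.free i

/-- The system after a trajectory that begins in the first period. -/
def sysAfter {n : ℕ} (d : ℕ) (h : Trajectory n) : Sys n :=
  h.foldl (fun s p => s.step d p.1 p.2) (Sys.start n)

/-- Total reward of a finite trajectory that begins in system `s`. -/
def val {n : ℕ} (d : ℕ) : Sys n → Trajectory n → ℕ
  | _, [] => 0
  | s, p :: l => s.reward p.1 p.2 + val d (s.step d p.1 p.2) l

/-- Largest total reward on the finite list `l` of requests, beginning in system `s`. -/
def opt {n : ℕ} (d : ℕ) (s : Sys n) (l : List (Request n)) : ℕ :=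
  Finset.univ.sup fun a : Fin l.length → Action n => val d s (l.zip (List.ofFn a))

/-- The system before period `t` under infinite request and action sequences. -/
def sysAt {n : ℕ} (d : ℕ) (e : ℕ → Request n) (a : ℕ → Action n) : ℕ → Sys n
  | 0 => Sys.start n
  | t + 1 => (sysAt d e a t).step d (e t) (a t)

/-- Hindsight optimum over an infinite (finite-support) request sequence. -/
def optSeq {n : ℕ} (d : ℕ) (e : ℕ → Request n) : ℝ :=
  ⨆ a : ℕ → Action n, ∑' t, ((sysAt d e a t).reward (e t) (a t) : ℝ)

/-- Only finitely many requests differ from the empty request. -/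
def FiniteSupport {n : ℕ} (e : ℕ → Request n) : Prop :=
  ∃ m, ∀ j, m ≤ j → e j = emptyRequest n

/-- The number of periods up to the last nonempty request (`0` if there is none). -/
def supportLength {n : ℕ} (e : ℕ → Request n) : ℕ :=
  sInf {m | ∀ j, m ≤ j → e j = emptyRequest n}

/-! ### Randomized online algorithms -/

/-- A randomized online algorithm: from the past trajectory, its private memory and the
current request it draws an action and its next memory. -/
structure OnlineAlg (n : ℕ) where
  Mem : Type
  first : Mem
  act : Trajectory n → Mem → Request n → PMF (Action n × Mem)

/-- Law of the trajectory and the memory after `t` periods. -/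
def OnlineAlg.run {n : ℕ} (P : OnlineAlg n) (e : ℕ → Request n) :
    ℕ → PMF (Trajectory n × P.Mem)
  | 0 => PMF.pure ([], P.first)
  | t + 1 => (P.run e t).bind fun x =>
      (P.act x.1 x.2 (e t)).map fun y => (x.1 ++ [(e t, y.1)], y.2)

/-- Expected total reward during the first `t` periods. -/
def OnlineAlg.valUpTo {n : ℕ} (P : OnlineAlg n) (d : ℕ) (e : ℕ → Request n) (t : ℕ) : ℝ≥0∞ :=
  ∑' x, P.run e t x * (val d (Sys.start n) x.1 : ℝ≥0∞)

/-- Expected total reward over all periods (the rewards are nonnegative, so this is the supremum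
over finite horizons). -/
def OnlineAlg.valSeq {n : ℕ} (P : OnlineAlg n) (d : ℕ) (e : ℕ → Request n) : ℝ :=
  (⨆ t, P.valUpTo d e t).toReal

/-- Competitive ratio of `P` on the request sequence `e`. -/
def comp {n : ℕ} (d : ℕ) (e : ℕ → Request n) (P : OnlineAlg n) : ℝ :=
  P.valSeq d e / optSeq d e

/-! ### Periodic Re-Ranking and its restarted version -/

open Classical in
/-- The resource of smallest rank among those that can serve `e`; `none` if there is none. -/
def bestRanked {n : ℕ} (s : Sys n) (σ : Equiv.Perm (Fin n)) (e : Request n) : Action n :=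
  ((List.finRange n).filter fun i => decide (s.CanServe e i)).argmin σ

/-- One period of Periodic Re-Ranking, `k` periods after it began: every `d` periods a fresh
uniformly random order of the resources is drawn (the order of independent uniform ranks), and the
request is given to the available eligible resource of smallest rank. -/
def prrStep {n : ℕ} (d k : ℕ) (s : Sys n) (σ : Equiv.Perm (Fin n)) (e : Request n) :
    PMF (Action n × Equiv.Perm (Fin n)) :=
  (if k % d = 0 then PMF.uniformOfFintype (Equiv.Perm (Fin n)) else PMF.pure σ).map
    fun τ => (bestRanked s τ e, τ)

/-- The online algorithm Periodic Re-Ranking. -/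
def prr (n d : ℕ) : OnlineAlg n where
  Mem := Equiv.Perm (Fin n)
  first := 1
  act := fun h σ e => prrStep d h.length (sysAfter d h) σ e

/-- The competitive ratio of Periodic Re-Ranking: the infimum over all numbers of resources, all
usage durations, and all finite-support request sequences with positive optimum. -/
def etaORRA : ℝ :=
  sInf {r | ∃ (n d : ℕ) (e : ℕ → Request n),
    1 ≤ d ∧ FiniteSupport e ∧ 0 < optSeq d e ∧ r = comp d e (prr n d)}

/-- The period in which the restarted algorithm, used after `m` elapsed periods, begins to run
Periodic Re-Ranking: at once if `m = 0`, otherwise after `d - 1` ignored requests, when all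
resources are available again. -/
def prrBegin (d m : ℕ) : ℕ := if m = 0 then 0 else m + (d - 1)

/-- One period of the `m`-th policy of the online oracle. -/
def prrStarStep {n : ℕ} (d m : ℕ) (s : Sys n) (σ : Equiv.Perm (Fin n)) (e : Request n) :
    PMF (Action n × Equiv.Perm (Fin n)) :=
  if s.time < prrBegin d m then PMF.pure (none, σ)
  else prrStep d (s.time - prrBegin d m) s σ e

/-- Law of the total reward of one simulated run of the `m`-th policy of the online oracle on the
requests `l`, beginning in system `s`. -/
def prrRollout {n : ℕ} (d m : ℕ) : Sys n → Equiv.Perm (Fin n) → List (Request n) → PMF ℕ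
  | _, _, [] => PMF.pure 0
  | s, σ, e :: l => (prrStarStep d m s σ e).bind fun y =>
      (prrRollout d m (s.step d e y.1) y.2 l).map fun r => s.reward e y.1 + r

/-- Law of the sum of `k` independent samples of `p`. -/
def iidSum (p : PMF ℕ) : ℕ → PMF ℕ
  | 0 => PMF.pure 0
  | k + 1 => p.bind fun x => (iidSum p k).map fun y => x + y

/-! ### Offline oracles -/

/-- `A` is a `γ`-offline oracle: after every trajectory `h` and for every nonempty finite list `l`
of further requests, `A h l` is a list of actions whose reward is at least `γ` times the optimum. -/
def IsOfflineOracle {n : ℕ} (d : ℕ) (γ : ℝ)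
    (A : Trajectory n → List (Request n) → List (Action n)) : Prop :=
  ∀ (h : Trajectory n) (l : List (Request n)), l ≠ [] →
    (A h l).length = l.length ∧
      γ * (opt d (sysAfter d h) l : ℝ) ≤ (val d (sysAfter d h) (l.zip (A h l)) : ℝ)

/-! ### AdaSwitch -/

/-- Everything that AdaSwitch is given: the prediction, the offline oracle, the parameters
(`samples` is the factor `H` in the number of simulations), and the arbitrary actions that it may
take once the rest of the prediction is worth too little (a sequence indexed by the period,
possibly chosen in dependence on the trajectory and the request at the start of the batch). -/
structure AdaInput (n : ℕ) where
  pred : ℕ → Request n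
  oracle : Trajectory n → List (Request n) → List (Action n)
  fallback : Trajectory n → Request n → ℕ → Action n
  samples : ℕ
  η : ℝ
  γ : ℝ
  ε : ℝ
  α : ℝ
  b : ℝ
  c : ℝ

/-- Memory of AdaSwitch. -/
structure AdaMem (n : ℕ) where
  /-- whether the state is predictive (otherwise it is conservative) -/
  predictive : Bool
  /-- first period of the current conservative phase -/
  begin_ : ℕ
  /-- the ranking used by the online oracle -/
  rank : Equiv.Perm (Fin n)
  /-- first period after the current batch; `none` is infinity -/
  batchEnd : Option ℕ
  /-- the actions planned for the current batch, indexed by the period -/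
  plan : ℕ → Action n
  /-- cumulative prediction error of the current predictive phase -/
  error : ℝ

/-- In the conservative state, the threshold for the estimated reward of the online oracle. -/
def AdaInput.rewardThreshold {n : ℕ} (I : AdaInput n) : ℝ := 16 * I.η / I.ε * (I.α * I.c)

/-- In the predictive state, the threshold for the cumulative prediction error. -/
def AdaInput.errorThreshold {n : ℕ} (I : AdaInput n) : ℝ :=
  I.γ * I.α / ((I.η - 15 / 16 * I.ε) * (I.α + I.γ)) * (5 * I.α * I.c / I.b)

/-- The effective length estimator after `t` elapsed periods. -/
def AdaInput.estimateM {n : ℕ} (I : AdaInput n) (t : ℕ) : ℕ := max t (supportLength I.pred)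

/-- The next `k` requests, beginning with the current request `e` in period `t`, under the
assumption that the prediction is correct from period `t + 1` on. -/
def AdaInput.horizon {n : ℕ} (I : AdaInput n) (t : ℕ) (e : Request n) (k : ℕ) :
    List (Request n) :=
  (List.range k).map fun j => if j = 0 then e else I.pred (t + j)

/-- Anticipated reward of the oracle's plan for a batch of length `k` that begins after the
trajectory `h` with the request `e`. -/
def AdaInput.planVal {n : ℕ} (d : ℕ) (I : AdaInput n) (h : Trajectory n) (e : Request n)
    (k : ℕ) : ℕ :=
  val d (sysAfter d h)
    ((I.horizon h.length e k).zip (I.oracle h (I.horizon h.length e k)))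

/-- The loop that extends a batch: it begins with length `0`, and continues as long as the batch
extended by one period stays within the estimated effective length and the anticipated reward is
below `α c`. Its result is the first length at which it stops. -/
def AdaInput.batchLength {n : ℕ} (d : ℕ) (I : AdaInput n) (h : Trajectory n) (e : Request n) :
    ℕ :=
  sInf {k | ¬ (h.length + k + 1 ≤ I.estimateM (h.length + 1) ∧
    (I.planVal d h e k : ℝ) < I.α * I.c)}

open Classical in
/-- End and plan of a batch that begins after the trajectory `h` with the request `e`. -/
def AdaInput.newBatch {n : ℕ} (d : ℕ) (I : AdaInput n) (h : Trajectory n) (e : Request n) :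
    Option ℕ × (ℕ → Action n) :=
  let k := I.batchLength d h e
  if (I.planVal d h e k : ℝ) < I.α * I.c then (none, I.fallback h e)
  else (some (h.length + k),
    fun j => (I.oracle h (I.horizon h.length e k)).getD (j - h.length) none)

open Classical in
/-- A period in the conservative state: follow the online oracle, and estimate its expected reward
since the beginning of the phase by the mean of `samples * (t + 1) ^ 5` independent simulations. -/
def AdaInput.conservativeAct {n : ℕ} (d : ℕ) (I : AdaInput n) (h : Trajectory n) (M : AdaMem n)
    (e : Request n) : PMF (Action n × AdaMem n) :=
  (prrStarStep d M.begin_ (sysAfter d h) M.rank e).bind fun y =>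
    (iidSum (prrRollout d M.begin_ (sysAfter d (h.take M.begin_)) 1
        ((h.drop M.begin_).map Prod.fst ++ [e]))
      (I.samples * (h.length + 1) ^ 5)).map fun total =>
        let estimate : ℝ := (total : ℝ) / ((I.samples * (h.length + 1) ^ 5 : ℕ) : ℝ)
        if I.rewardThreshold ≤ estimate then
          (y.1, { M with
            predictive := true, rank := y.2, batchEnd := some (h.length + 1), error := 0 })
        else (y.1, { M with rank := y.2 })

open Classical in
/-- A period in the predictive state: start a new batch if the current one is over, execute the
planned action, and return to the conservative state once the prediction error is too large. -/
def AdaInput.predictiveAct {n : ℕ} (d : ℕ) (I : AdaInput n) (h : Trajectory n) (M : AdaMem n)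
    (e : Request n) : Action n × AdaMem n :=
  let t := h.length
  let batch := if M.batchEnd = some t then I.newBatch d h e else (M.batchEnd, M.plan)
  let error' : ℝ := M.error + min (if e = I.pred t then 0 else 1) (I.c / I.b)
  let M' : AdaMem n := { M with batchEnd := batch.1, plan := batch.2, error := error' }
  (batch.2 t,
    if I.errorThreshold ≤ error' then { M' with predictive := false, begin_ := t + 1 } else M')

/-- AdaSwitch with a `γ`-offline oracle, and the restarted Periodic Re-Ranking as online oracle. -/
def adaSwitch {n : ℕ} (d : ℕ) (I : AdaInput n) : OnlineAlg n where
  Mem := AdaMem n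
  first :=
    { predictive := false, begin_ := 0, rank := 1, batchEnd := none, plan := fun _ => none,
      error := 0 }
  act := fun h M e =>
    if M.predictive then PMF.pure (I.predictiveAct d h M e) else I.conservativeAct d h M e

/-- AdaSwitch-ORRA: AdaSwitch with `c = d` and `b = 2`. -/
def adaSwitchORRA {n : ℕ} (d : ℕ) (η γ ε α : ℝ) (H : ℕ)
    (A : Trajectory n → List (Request n) → List (Action n))
    (fallback : Trajectory n → Request n → ℕ → Action n) (pred : ℕ → Request n) : OnlineAlg n :=
  adaSwitch d
    { pred := pred, oracle := A, fallback := fallback, samples := H,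
      η := η, γ := γ, ε := ε, α := α, b := 2, c := d }

/-- The prediction error: the number of periods in which prediction and request differ. -/
def predError {n : ℕ} (e pred : ℕ → Request n) : ℝ :=
  ∑' t, if e t = pred t then 0 else 1

end ORRA

end

noncomputable section

namespace ORRA

/-! ### Expectation under finitely supported laws -/

/-! Write κ = γα/(α+γ). Both bounds have the form "ratio times the optimum of the remaining
requests, minus a loss" and come from one induction on the number of remaining periods, run for the
two states simultaneously (`le_toGo_adaSwitch`). A loss function `S` belongs to the start of a
conservative phase, a loss function `U` to the start of a batch with given accumulated error; each
bound is a choice of ratio, `S` and `U`. Since the optimum with all resources available is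
subadditive (`optSeg_add_le`), the horizon can be cut into phases and batches.

Predictive state. Executing the same actions in two systems on two request lists changes the reward
by at most the number of resources that return later in the second system plus the number of
differing requests (`val_le_val`). Hence busy resources cost at most d - 1, and each wrong
prediction costs at most one unit of planned reward and one of optimum. A completed batch has
planned reward V ≥ αd and V ≥ γ·O, where O is the optimum on the anticipated requests; a weighted
combination gives V ≥ κ(O + d), so the batch itself pays for the resources that were busy at its
start (`batch_full`). An unfinished batch costs at most αd (`batch_partial`).

Conservative state. The simulations are fresh and start from the system at the beginning of the
phase, so the switching probabilities do not depend on the actual run within the phase. The phase is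
therefore Periodic Re-Ranking stopped at an independent random time (`stopAvg_le_toGo`), and a
one-step inequality suffices to bound it (`le_stopAvg`). By Chebyshev, H t^5 simulations make a
wrong decision in period t with probability O(1/t^3), which is summable and is absorbed by a
telescoping term in the losses.

Robustness (`robust_le_toGo`): the kept ratio is η - 15ε/16. A phase left near or above the reward
threshold has earned a surplus over this ratio that covers all possible loss of the following
predictive phase, because the error threshold limits that loss; only premature switches remain.
Consistency (`consistent_le_toGo`): the ratio is κ. Every wrong prediction pays a price of which a
part is saved, and when the error threshold is reached the savings cover one whole conservative
phase. -/

/-- Expectation of a real function. -/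
def ex {β : Type*} (p : PMF β) (f : β → ℝ) : ℝ := ∑' x, (p x).toReal * f x

section Expectation

variable {β δ : Type*}

lemma ex_eq_sum {p : PMF β} (hp : p.support.Finite) (f : β → ℝ) :
    ex p f = ∑ x ∈ hp.toFinset, (p x).toReal * f x := by
  refine tsum_eq_sum fun x hx => ?_
  simp only [Set.Finite.mem_toFinset, PMF.mem_support_iff, not_not] at hx
  simp [hx]

lemma ex_pure (a : β) (f : β → ℝ) : ex (PMF.pure a) f = f a := by
  unfold ex
  rw [tsum_eq_single a]
  · simp
  · intro b hb
    simp [PMF.pure_apply, hb]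

lemma support_pure_finite (a : β) : (PMF.pure a).support.Finite := by simp

lemma support_bind_finite {p : PMF β} {q : β → PMF δ} (hp : p.support.Finite)
    (hq : ∀ a, (q a).support.Finite) : (p.bind q).support.Finite := by
  rw [PMF.support_bind]
  exact hp.biUnion fun a _ => hq a

lemma support_map_finite {p : PMF β} (hp : p.support.Finite) (g : β → δ) :
    (p.map g).support.Finite := by
  rw [PMF.support_map]
  exact hp.image g

lemma sum_toReal {p : PMF β} (hp : p.support.Finite) :
    ∑ x ∈ hp.toFinset, (p x).toReal = 1 := by
  rw [← ENNReal.toReal_sum fun x _ => p.apply_ne_top x]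
  have : ∑ x ∈ hp.toFinset, p x = 1 := by
    rw [← p.tsum_coe]
    symm
    refine tsum_eq_sum fun x hx => ?_
    simpa using hx
  simp [this]

lemma ex_const {p : PMF β} (hp : p.support.Finite) (r : ℝ) : ex p (fun _ => r) = r := by
  rw [ex_eq_sum hp, ← Finset.sum_mul, sum_toReal hp, one_mul]

lemma ex_add {p : PMF β} (hp : p.support.Finite) (f g : β → ℝ) :
    ex p (fun x => f x + g x) = ex p f + ex p g := by
  simp only [ex_eq_sum hp, ← Finset.sum_add_distrib, mul_add]

lemma ex_sub {p : PMF β} (hp : p.support.Finite) (f g : β → ℝ) :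
    ex p (fun x => f x - g x) = ex p f - ex p g := by
  simp only [ex_eq_sum hp, ← Finset.sum_sub_distrib, mul_sub]

lemma ex_mul_left (p : PMF β) (r : ℝ) (f : β → ℝ) :
    ex p (fun x => r * f x) = r * ex p f := by
  unfold ex
  rw [← tsum_mul_left]
  exact tsum_congr fun x => by ring

lemma ex_mono {p : PMF β} (hp : p.support.Finite) {f g : β → ℝ}
    (h : ∀ x ∈ p.support, f x ≤ g x) : ex p f ≤ ex p g := by
  rw [ex_eq_sum hp, ex_eq_sum hp]
  refine Finset.sum_le_sum fun x hx => ?_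
  exact mul_le_mul_of_nonneg_left (h x (by simpa using hx)) ENNReal.toReal_nonneg

lemma ex_congr {p : PMF β} {f g : β → ℝ} (h : ∀ x ∈ p.support, f x = g x) :
    ex p f = ex p g := by
  refine tsum_congr fun x => ?_
  by_cases hx : x ∈ p.support
  · rw [h x hx]
  · rw [PMF.mem_support_iff, not_not] at hx
    simp [hx]

lemma ex_nonneg {p : PMF β} {f : β → ℝ} (h : ∀ x, 0 ≤ f x) : 0 ≤ ex p f :=
  tsum_nonneg fun x => mul_nonneg ENNReal.toReal_nonneg (h x)

lemma ex_le_of_le {p : PMF β} (hp : p.support.Finite) {f : β → ℝ} {r : ℝ}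
    (h : ∀ x ∈ p.support, f x ≤ r) : ex p f ≤ r :=
  (ex_mono hp h).trans (ex_const hp r).le

lemma ex_bind {p : PMF β} {q : β → PMF δ} (hp : p.support.Finite)
    (hq : ∀ a, (q a).support.Finite) (f : δ → ℝ) :
    ex (p.bind q) f = ex p fun a => ex (q a) f := by
  classical
  have hb := support_bind_finite hp hq
  rw [ex_eq_sum hb, ex_eq_sum hp]
  have key : ∀ x, ((p.bind q) x).toReal = ∑ a ∈ hp.toFinset, (p a).toReal * (q a x).toReal := by
    intro x
    rw [PMF.bind_apply, tsum_eq_sum (s := hp.toFinset), ENNReal.toReal_sum]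
    · simp [ENNReal.toReal_mul]
    · intro a _
      exact ENNReal.mul_ne_top (p.apply_ne_top a) ((q a).apply_ne_top x)
    · intro a ha
      simp only [Set.Finite.mem_toFinset, PMF.mem_support_iff, not_not] at ha
      simp [ha]
  simp only [key, Finset.sum_mul]
  rw [Finset.sum_comm]
  refine Finset.sum_congr rfl fun a ha => ?_
  rw [ex_eq_sum (hq a), Finset.mul_sum]
  symm
  rw [Finset.sum_subset (s₁ := (hq a).toFinset) (s₂ := hb.toFinset)]
  · exact Finset.sum_congr rfl fun x _ => by ring
  · intro x hx
    simp only [Set.Finite.mem_toFinset] at hx ha ⊢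
    rw [PMF.mem_support_bind_iff]
    exact ⟨a, ha, hx⟩
  · intro x _ hx
    simp only [Set.Finite.mem_toFinset, PMF.mem_support_iff, not_not] at hx
    simp [hx]

lemma ex_map {p : PMF β} (hp : p.support.Finite) (g : β → δ) (f : δ → ℝ) :
    ex (p.map g) f = ex p fun a => f (g a) := by
  rw [← PMF.bind_pure_comp, ex_bind hp (q := PMF.pure ∘ g) fun a => support_pure_finite _]
  simp [ex_pure]

open Classical in
lemma ex_ite {p : PMF β} (hp : p.support.Finite) (c : β → Prop) (r r' : ℝ) :
    ex p (fun x => if c x then r else r') =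
      ex p (fun x => if c x then 1 else 0) * r +
        (1 - ex p (fun x => if c x then 1 else 0)) * r' := by
  have : (fun x => if c x then r else r') =
      fun x => (r - r') * (if c x then 1 else 0) + r' := by
    funext x
    split_ifs <;> ring
  rw [this, ex_add hp, ex_const hp, ex_mul_left]
  ring

lemma toReal_tsum_natCast (p : PMF β) (f : β → ℕ) :
    (∑' x, p x * (f x : ℝ≥0∞)).toReal = ex p fun x => (f x : ℝ) := by
  rw [ENNReal.tsum_toReal_eq]
  · simp [ex, ENNReal.toReal_mul]
  · intro x
    exact ENNReal.mul_ne_top (p.apply_ne_top x) (ENNReal.natCast_ne_top _)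

end Expectation

/-! ### Chebyshev's inequality for sums of independent samples -/

lemma support_iidSum_finite {p : PMF ℕ} (hp : p.support.Finite) (k : ℕ) :
    (iidSum p k).support.Finite := by
  induction k with
  | zero => exact support_pure_finite 0
  | succ k ih => exact support_bind_finite hp fun x => support_map_finite ih _

lemma ex_iidSum_centered {p : PMF ℕ} (hp : p.support.Finite) (k : ℕ) :
    ex (iidSum p k) (fun x => (x : ℝ) - k * ex p (fun x => (x : ℝ))) = 0 := by
  induction k with
  | zero => simp [iidSum, ex_pure]
  | succ k ih =>
    set μ := ex p (fun x => (x : ℝ)) with hμ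
    rw [iidSum, ex_bind hp fun x => support_map_finite (support_iidSum_finite hp k) _]
    have : ∀ x : ℕ, ex ((iidSum p k).map fun y => x + y)
        (fun x => (x : ℝ) - ((k + 1 : ℕ) : ℝ) * μ) = (x : ℝ) - μ := by
      intro x
      rw [ex_map (support_iidSum_finite hp k)]
      have : (fun a : ℕ => ((x + a : ℕ) : ℝ) - ((k + 1 : ℕ) : ℝ) * μ) =
          fun a : ℕ => ((a : ℝ) - k * μ) + ((x : ℝ) - μ) := by
        funext a; push_cast; ring
      rw [this, ex_add (support_iidSum_finite hp k), ih,
        ex_const (support_iidSum_finite hp k), zero_add]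
    simp only [this]
    rw [ex_sub hp, ex_const hp, ← hμ, sub_self]

/-- Variances add up, since the cross term vanishes by `ex_iidSum_centered`; one sample and its mean
both lie between 0 and `u`. -/
lemma ex_iidSum_sq_le {p : PMF ℕ} (hp : p.support.Finite) {u : ℕ}
    (hu : ∀ x ∈ p.support, x ≤ u) (k : ℕ) :
    ex (iidSum p k) (fun x => ((x : ℝ) - k * ex p (fun x => (x : ℝ))) ^ 2) ≤ k * (u : ℝ) ^ 2 := by
  have hμ0 : 0 ≤ ex p (fun x => (x : ℝ)) := ex_nonneg fun x => Nat.cast_nonneg x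
  have hμu : ex p (fun x => (x : ℝ)) ≤ u := ex_le_of_le hp fun x hx => by exact_mod_cast hu x hx
  induction k with
  | zero => simp [iidSum, ex_pure]
  | succ k ih =>
    have hc := ex_iidSum_centered hp k
    set μ := ex p (fun x => (x : ℝ)) with hμ
    have hk := support_iidSum_finite hp k
    rw [iidSum, ex_bind hp fun x => support_map_finite hk _]
    have : ∀ x : ℕ, ex ((iidSum p k).map fun y => x + y)
        (fun x => ((x : ℝ) - ((k + 1 : ℕ) : ℝ) * μ) ^ 2) =
        ex (iidSum p k) (fun x => ((x : ℝ) - k * μ) ^ 2) + ((x : ℝ) - μ) ^ 2 := by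
      intro x
      rw [ex_map hk]
      have : (fun a : ℕ => (((x + a : ℕ) : ℝ) - ((k + 1 : ℕ) : ℝ) * μ) ^ 2) =
          fun a : ℕ => (((a : ℝ) - k * μ) ^ 2 + (2 * ((x : ℝ) - μ)) * ((a : ℝ) - k * μ)) +
            ((x : ℝ) - μ) ^ 2 := by
        funext a; push_cast; ring
      rw [this, ex_add hk, ex_add hk, ex_mul_left, hc, ex_const hk, mul_zero, add_zero]
    simp only [this]
    rw [ex_add hp, ex_const hp]
    have hv : ex p (fun x => ((x : ℝ) - μ) ^ 2) ≤ (u : ℝ) ^ 2 := by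
      refine ex_le_of_le hp fun x hx => ?_
      have h1 : (x : ℝ) ≤ u := by exact_mod_cast hu x hx
      have h0 : (0 : ℝ) ≤ x := Nat.cast_nonneg x
      exact sq_le_sq' (by linarith) (by linarith)
    push_cast
    linarith

open Classical in
-- Markov's inequality for the squared deviation of the sum. The event is an arbitrary predicate
-- that forces a deviation, so that both tails are covered.
lemma ex_indicator_le {p : PMF ℕ} (hp : p.support.Finite) {u : ℕ}
    (hu : ∀ x ∈ p.support, x ≤ u) {N : ℕ} (hN : 0 < N) {Δ : ℝ} (hΔ : 0 < Δ) (c : ℕ → Prop)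
    (hc : ∀ x, c x → Δ ≤ |(x : ℝ) / N - ex p (fun x => (x : ℝ))|) :
    ex (iidSum p N) (fun x => if c x then 1 else 0) ≤ (u : ℝ) ^ 2 / (N * Δ ^ 2) := by
  have hN' : (0 : ℝ) < N := by exact_mod_cast hN
  set μ := ex p (fun x => (x : ℝ)) with hμ
  have h1 : ex (iidSum p N) (fun x => if c x then (1 : ℝ) else 0) ≤
      ex (iidSum p N) (fun x => ((N : ℝ) ^ 2 * Δ ^ 2)⁻¹ * ((x : ℝ) - N * μ) ^ 2) := by
    refine ex_mono (support_iidSum_finite hp N) fun x _ => ?_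
    split_ifs with h
    · have h2 : N * Δ ≤ |(x : ℝ) - N * μ| := by
        have h3 : (x : ℝ) - N * μ = N * ((x : ℝ) / N - μ) := by field_simp
        rw [h3, abs_mul, abs_of_pos hN']
        exact mul_le_mul_of_nonneg_left (hc x h) hN'.le
      have h4 : (N * Δ) ^ 2 ≤ ((x : ℝ) - N * μ) ^ 2 := by
        rw [← sq_abs ((x : ℝ) - N * μ)]
        exact pow_le_pow_left₀ (by positivity) h2 2
      rw [inv_mul_eq_div, le_div_iff₀ (by positivity)]
      nlinarith
    · positivity
  refine h1.trans ?_
  rw [ex_mul_left]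
  have h5 := ex_iidSum_sq_le hp hu N
  calc ((N : ℝ) ^ 2 * Δ ^ 2)⁻¹ * _ ≤ ((N : ℝ) ^ 2 * Δ ^ 2)⁻¹ * (N * (u : ℝ) ^ 2) :=
        mul_le_mul_of_nonneg_left h5 (by positivity)
    _ = (u : ℝ) ^ 2 / (N * Δ ^ 2) := by field_simp

/-! ### Comparison of systems -/

section Systems

variable {n d : ℕ}

/-- Number of periods for which resource `i` remains unavailable. -/
def Sys.wait (s : Sys n) (i : Fin n) : ℕ := s.free i - s.time

lemma Sys.canServe_iff (s : Sys n) (e : Request n) (i : Fin n) :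
    s.CanServe e i ↔ e i = true ∧ s.wait i = 0 := by
  unfold Sys.CanServe Sys.wait
  rw [Nat.sub_eq_zero_iff_le]

lemma Sys.wait_start (i : Fin n) : (Sys.start n).wait i = 0 := rfl

open Classical in
lemma Sys.wait_step (s : Sys n) (e : Request n) (a : Action n) (i : Fin n) :
    (s.step d e a).wait i = if a = some i ∧ s.CanServe e i then d - 1 else s.wait i - 1 := by
  unfold Sys.wait Sys.step
  dsimp only
  split_ifs <;> omega

open Classical in
lemma Sys.reward_eq_sum (s : Sys n) (e : Request n) (a : Action n) :
    s.reward e a = ∑ i, if a = some i ∧ s.CanServe e i then 1 else 0 := by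
  unfold Sys.reward
  cases a with
  | none => simp
  | some j =>
    rw [Finset.sum_eq_single j]
    · simp
    · intro i _ hi
      simp [hi.symm]
    · simp

lemma Sys.reward_le_one (s : Sys n) (e : Request n) (a : Action n) : s.reward e a ≤ 1 := by
  unfold Sys.reward
  split_ifs <;> omega

lemma Sys.reward_emptyRequest (s : Sys n) (a : Action n) :
    s.reward (emptyRequest n) a = 0 := by
  unfold Sys.reward Sys.CanServe emptyRequest
  simp

/-- Invariants of systems that are reached from the start: fewer than `d` periods of waiting, and
no two unavailable resources wait equally long. -/
structure Sys.Reachable (d : ℕ) (s : Sys n) : Prop where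
  wait_lt : ∀ i, s.wait i < d
  inj : ∀ i j, s.wait i = s.wait j → 0 < s.wait i → i = j

lemma Sys.Reachable.start (hd : 1 ≤ d) : (Sys.start n).Reachable d :=
  ⟨fun i => by rw [Sys.wait_start]; omega, fun i j _ h => by simp [Sys.wait_start] at h⟩

/-- At most one resource is assigned per period. It starts to wait for d - 1 periods, while every
other positive wait has just dropped to at most d - 2, so no two positive waits can coincide. -/
lemma Sys.Reachable.step {s : Sys n} (hs : s.Reachable d) (e : Request n) (a : Action n) :
    (s.step d e a).Reachable d := by
  refine ⟨fun i => ?_, fun i j hij hi => ?_⟩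
  · have := hs.wait_lt i
    rw [Sys.wait_step]
    split_ifs <;> omega
  · have h1 := hs.wait_lt i
    have h2 := hs.wait_lt j
    rw [Sys.wait_step] at hij hi
    rw [Sys.wait_step] at hij
    split_ifs at hij hi with h3 h4 h5
    · have := h3.1.symm.trans h4.1
      exact Option.some.inj this
    · omega
    · omega
    · exact hs.inj i j (by omega) (by omega)

lemma Sys.Reachable.foldl {s : Sys n} (hs : s.Reachable d) (h : Trajectory n) :
    (h.foldl (fun s p => s.step d p.1 p.2) s).Reachable d := by
  induction h generalizing s with
  | nil => exact hs
  | cons p h ih => exact ih (hs.step p.1 p.2)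

lemma sysAfter_reachable (hd : 1 ≤ d) (h : Trajectory n) : (sysAfter d h).Reachable d :=
  (Sys.Reachable.start hd).foldl h

lemma foldl_step_time (s : Sys n) (h : Trajectory n) :
    (h.foldl (fun s p => s.step d p.1 p.2) s).time = s.time + h.length := by
  induction h generalizing s with
  | nil => rfl
  | cons p h ih =>
    rw [List.foldl_cons, ih, List.length_cons]
    simp only [Sys.step]
    omega

lemma sysAfter_time (h : Trajectory n) : (sysAfter d h).time = h.length := by
  unfold sysAfter
  rw [foldl_step_time]
  simp [Sys.start]

lemma sysAfter_append (h g : Trajectory n) :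
    sysAfter d (h ++ g) = g.foldl (fun s p => s.step d p.1 p.2) (sysAfter d h) := by
  unfold sysAfter
  rw [List.foldl_append]

lemma sysAfter_concat (h : Trajectory n) (e : Request n) (a : Action n) :
    sysAfter d (h ++ [(e, a)]) = (sysAfter d h).step d e a := by
  rw [sysAfter_append]
  rfl

lemma val_append (s : Sys n) (h g : Trajectory n) :
    val d s (h ++ g) = val d s h + val d (h.foldl (fun s p => s.step d p.1 p.2) s) g := by
  induction h generalizing s with
  | nil => simp [val]
  | cons p h ih => simp only [List.cons_append, val, ih, List.foldl_cons]; omega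

lemma val_concat (h : Trajectory n) (e : Request n) (a : Action n) :
    val d (Sys.start n) (h ++ [(e, a)]) =
      val d (Sys.start n) h + (sysAfter d h).reward e a := by
  rw [val_append]
  simp [val, sysAfter]

lemma val_le_length (s : Sys n) (h : Trajectory n) : val d s h ≤ h.length := by
  induction h generalizing s with
  | nil => simp [val]
  | cons p h ih =>
    have h1 := s.reward_le_one p.1 p.2
    have h2 := ih (s.step d p.1 p.2)
    simp only [val, List.length_cons]
    omega

/-- Number of resources that are available later in `s'` than in `s`. -/
def lag (s s' : Sys n) : ℕ := ∑ i, if s.wait i < s'.wait i then 1 else 0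

open Classical in
/-- Number of positions at which two lists of requests differ. -/
def mismatches (l l' : List (Request n)) : ℕ :=
  (List.zipWith (fun x y => if x = y then 0 else 1) l l').sum

lemma lag_start (s : Sys n) : lag s (Sys.start n) = 0 := by
  simp [lag, Sys.wait_start]

/-- The waits of the unavailable resources are distinct elements of {1, ..., d - 1}. -/
lemma start_lag_le {s : Sys n} (hs : s.Reachable d) : lag (Sys.start n) s ≤ d - 1 := by
  rw [lag, ← Finset.card_filter]
  have : (Finset.Icc 1 (d - 1)).card = d - 1 := by simp
  rw [← this]
  refine Finset.card_le_card_of_injOn s.wait ?_ ?_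
  · intro i hi
    have h1 := hs.wait_lt i
    have h2 : 0 < s.wait i := (Finset.mem_filter.mp hi).2
    simp only [Finset.coe_Icc, Set.mem_Icc]
    omega
  · intro i hi j _ hij
    exact hs.inj i j hij (Finset.mem_filter.mp hi).2

open Classical in
-- The lag is a potential, checked resource by resource. If the assigned resource serves only in
-- `s`, either the requests differ there, or it was still busy in `s'`; in the latter case it
-- counted towards the lag before and no longer does, because it now waits d - 1 periods in `s` and
-- at most that long in `s'`.
lemma reward_add_lag_le {s s' : Sys n} (hs' : ∀ i, s'.wait i < d) (x y : Request n)
    (a : Action n) :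
    s.reward x a + lag (s.step d x a) (s'.step d y a) ≤
      s'.reward y a + lag s s' + (if x = y then 0 else 1) := by
  have hmis : (∑ i : Fin n, if a = some i ∧ x i ≠ y i then 1 else 0) ≤
      if x = y then 0 else 1 := by
    split_ifs with h
    · subst h; simp
    · cases a with
      | none => simp
      | some j =>
        rw [Finset.sum_eq_single j]
        · split_ifs <;> omega
        · intro i _ hi
          simp [hi.symm]
        · simp
  refine le_trans ?_ (Nat.add_le_add_left hmis _)
  rw [Sys.reward_eq_sum, Sys.reward_eq_sum, lag, lag, ← Finset.sum_add_distrib,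
    ← Finset.sum_add_distrib, ← Finset.sum_add_distrib]
  refine Finset.sum_le_sum fun i _ => ?_
  have h1 := hs' i
  simp only [Sys.wait_step, Sys.canServe_iff]
  by_cases ha : a = some i
  · cases hx : x i <;> cases hy : y i <;> simp [ha] <;> split_ifs <;> omega
  · simp only [ha, false_and, if_false]
    split_ifs <;> omega

lemma val_le_val {s s' : Sys n} (hs' : s'.Reachable d) (l l' : List (Request n))
    (a : List (Action n)) (hl : l.length = l'.length) :
    val d s (l.zip a) ≤ val d s' (l'.zip a) + lag s s' + mismatches l l' := by
  induction l generalizing s s' l' a with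
  | nil => simp [val]
  | cons x l ih =>
    cases l' with
    | nil => simp at hl
    | cons y l' =>
      cases a with
      | nil => simp [val]
      | cons b a =>
        have h1 := ih (hs'.step y b) l' a (by simpa using hl) (s := s.step d x b)
        have h2 := reward_add_lag_le (s := s) hs'.wait_lt x y b
        simp only [List.zip_cons_cons, val]
        have h3 : mismatches (x :: l) (y :: l') = (if x = y then 0 else 1) + mismatches l l' := by
          simp [mismatches]
        rw [h3]
        omega

lemma val_le_opt (s : Sys n) (l : List (Request n)) (a : List (Action n))
    (h : a.length = l.length) : val d s (l.zip a) ≤ opt d s l := by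
  unfold opt
  have := Finset.le_sup (s := Finset.univ)
    (f := fun a : Fin l.length → Action n => val d s (l.zip (List.ofFn a)))
    (Finset.mem_univ fun i : Fin l.length => a.get (i.cast h.symm))
  refine le_of_eq_of_le ?_ this
  congr 2
  apply List.ext_getElem
  · simp [h]
  · intro i h1 h2
    simp

lemma exists_val_eq_opt (s : Sys n) (l : List (Request n)) :
    ∃ a : List (Action n), a.length = l.length ∧ val d s (l.zip a) = opt d s l := by
  obtain ⟨a, -, ha⟩ := Finset.exists_mem_eq_sup
    (Finset.univ : Finset (Fin l.length → Action n)) Finset.univ_nonempty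
    (fun a => val d s (l.zip (List.ofFn a)))
  exact ⟨List.ofFn a, by simp, ha.symm⟩

lemma opt_le_opt {s s' : Sys n} (hs' : s'.Reachable d) (l l' : List (Request n))
    (hl : l.length = l'.length) :
    opt d s l ≤ opt d s' l' + lag s s' + mismatches l l' := by
  obtain ⟨a, ha, h⟩ := exists_val_eq_opt (d := d) s l
  have h1 := val_le_val (s := s) hs' l l' a hl
  have h2 := val_le_opt (d := d) s' l' a (ha.trans hl)
  omega

lemma opt_le_length (s : Sys n) (l : List (Request n)) : opt d s l ≤ l.length := by
  obtain ⟨a, ha, h⟩ := exists_val_eq_opt (d := d) s l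
  have := val_le_length (d := d) s (l.zip a)
  simp [ha] at this
  omega

lemma mismatches_self (l : List (Request n)) : mismatches l l = 0 := by
  induction l with
  | nil => rfl
  | cons x l ih => simp [mismatches]

lemma mismatches_comm (l l' : List (Request n)) : mismatches l l' = mismatches l' l := by
  unfold mismatches
  rw [List.zipWith_comm]
  simp only [eq_comm]

lemma opt_le_opt_start (hd : 1 ≤ d) (s : Sys n) (l : List (Request n)) :
    opt d s l ≤ opt d (Sys.start n) l := by
  have := opt_le_opt (s := s) (Sys.Reachable.start hd) l l rfl
  rw [lag_start, mismatches_self] at this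
  exact this

lemma opt_start_le {s : Sys n} (hs : s.Reachable d) (l : List (Request n)) :
    opt d (Sys.start n) l ≤ opt d s l + (d - 1) := by
  have h1 := opt_le_opt (s := Sys.start n) hs l l rfl
  have h2 := start_lag_le hs
  rw [mismatches_self] at h1
  omega

/-- Cut an optimal action list in two; the second half earns at least as much when all resources are
free. -/
lemma opt_append_le (hd : 1 ≤ d) (s : Sys n) (l l' : List (Request n)) :
    opt d s (l ++ l') ≤ opt d s l + opt d (Sys.start n) l' := by
  obtain ⟨a, ha, h⟩ := exists_val_eq_opt (d := d) s (l ++ l')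
  rw [← h]
  rw [List.length_append] at ha
  have h1 : (l ++ l').zip a = l.zip (a.take l.length) ++ l'.zip (a.drop l.length) := by
    conv_lhs => rw [← List.take_append_drop l.length a]
    rw [List.zip_append]
    simp [ha]
  rw [h1, val_append]
  refine Nat.add_le_add (val_le_opt _ _ _ (by simp [ha])) ?_
  exact (val_le_opt _ _ _ (by simp [ha])).trans (opt_le_opt_start hd _ _)

lemma val_eq_zero (s : Sys n) (h : Trajectory n) (hh : ∀ p ∈ h, p.1 = emptyRequest n) :
    val d s h = 0 := by
  induction h generalizing s with
  | nil => rfl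
  | cons p h ih =>
    rw [val, hh p (by simp), Sys.reward_emptyRequest, ih _ fun q hq => hh q (by simp [hq])]

lemma opt_eq_zero (s : Sys n) (l : List (Request n)) (h : ∀ x ∈ l, x = emptyRequest n) :
    opt d s l = 0 := by
  obtain ⟨a, ha, h1⟩ := exists_val_eq_opt (d := d) s l
  rw [← h1]
  refine val_eq_zero _ _ fun p hp => h _ ?_
  exact (List.of_mem_zip (a := p.1) (b := p.2) hp).1

/-! ### Segments of a sequence of requests -/

/-- The `k` requests that begin with period `t`. -/
def seg (e : ℕ → Request n) (t k : ℕ) : List (Request n) := (List.range k).map fun j => e (t + j)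

@[simp] lemma seg_length (e : ℕ → Request n) (t k : ℕ) : (seg e t k).length = k := by simp [seg]

@[simp] lemma seg_zero (e : ℕ → Request n) (t : ℕ) : seg e t 0 = [] := rfl

lemma seg_add (e : ℕ → Request n) (t k m : ℕ) : seg e t (k + m) = seg e t k ++ seg e (t + k) m := by
  simp [seg, List.range_add, Function.comp_def, add_assoc]

lemma seg_succ (e : ℕ → Request n) (t k : ℕ) : seg e t (k + 1) = e t :: seg e (t + 1) k := by
  rw [add_comm k 1, seg_add]
  rfl

lemma seg_concat (e : ℕ → Request n) (t k : ℕ) : seg e t (k + 1) = seg e t k ++ [e (t + k)] := by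
  rw [seg_add]
  rfl

/-- Hindsight optimum over `k` periods that begin with period `t` if then all resources are
available. -/
def optSeg (d : ℕ) (e : ℕ → Request n) (t k : ℕ) : ℕ := opt d (Sys.start n) (seg e t k)

lemma optSeg_zero (e : ℕ → Request n) (t : ℕ) : optSeg d e t 0 = 0 :=
  Nat.le_zero.mp (opt_le_length _ _)

lemma optSeg_le (e : ℕ → Request n) (t k : ℕ) : optSeg d e t k ≤ k :=
  (opt_le_length _ _).trans (seg_length e t k).le

lemma optSeg_add_le (hd : 1 ≤ d) (e : ℕ → Request n) (t k m : ℕ) :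
    optSeg d e t (k + m) ≤ optSeg d e t k + optSeg d e (t + k) m := by
  unfold optSeg
  rw [seg_add]
  exact opt_append_le hd _ _ _

lemma optSeg_eq_zero {e : ℕ → Request n} {t : ℕ} (h : ∀ j, t ≤ j → e j = emptyRequest n) (k : ℕ) :
    optSeg d e t k = 0 := by
  refine opt_eq_zero _ _ fun x hx => ?_
  simp only [seg, List.mem_map] at hx
  obtain ⟨j, -, rfl⟩ := hx
  exact h _ (by omega)

/-! ### The optimum of an infinite sequence -/

lemma sysAt_eq (e : ℕ → Request n) (a : ℕ → Action n) (t : ℕ) :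
    sysAt d e a t = sysAfter d ((List.range t).map fun j => (e j, a j)) := by
  induction t with
  | zero => rfl
  | succ t ih =>
    rw [List.range_succ, List.map_append, List.map_singleton, sysAfter_concat, ← ih]
    rfl

lemma sum_reward_eq (e : ℕ → Request n) (a : ℕ → Action n) (t : ℕ) :
    ∑ j ∈ Finset.range t, (sysAt d e a j).reward (e j) (a j) =
      val d (Sys.start n) ((List.range t).map fun j => (e j, a j)) := by
  induction t with
  | zero => rfl
  | succ t ih =>
    rw [Finset.sum_range_succ, ih, List.range_succ, List.map_append, List.map_singleton,
      val_concat, sysAt_eq]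

lemma tsum_reward_eq {e : ℕ → Request n} {m : ℕ} (he : ∀ j, m ≤ j → e j = emptyRequest n)
    (a : ℕ → Action n) :
    ∑' t, ((sysAt d e a t).reward (e t) (a t) : ℝ) =
      val d (Sys.start n) ((List.range m).map fun j => (e j, a j)) := by
  rw [tsum_eq_sum (s := Finset.range m), ← sum_reward_eq]
  · push_cast; rfl
  · intro t ht
    rw [he t (by simpa using ht), Sys.reward_emptyRequest]
    simp

lemma val_seq_le (e : ℕ → Request n) (a : ℕ → Action n) (m : ℕ) :
    val d (Sys.start n) ((List.range m).map fun j => (e j, a j)) ≤ optSeg d e 0 m := by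
  have : ((List.range m).map fun j => (e j, a j)) = (seg e 0 m).zip ((List.range m).map a) := by
    simp [seg, List.zip_map']
  rw [this]
  exact val_le_opt _ _ _ (by simp)

lemma optSeq_eq {e : ℕ → Request n} {m : ℕ} (he : ∀ j, m ≤ j → e j = emptyRequest n) :
    optSeq d e = optSeg d e 0 m := by
  unfold optSeq
  simp only [tsum_reward_eq he]
  apply le_antisymm
  · refine ciSup_le fun a => ?_
    have := val_seq_le (d := d) e a m
    exact_mod_cast this
  · obtain ⟨a, ha, h1⟩ := exists_val_eq_opt (d := d) (Sys.start n) (seg e 0 m)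
    have hb : BddAbove (Set.range fun a : ℕ → Action n =>
        ((val d (Sys.start n) ((List.range m).map fun j => (e j, a j)) : ℕ) : ℝ)) := by
      refine ⟨optSeg d e 0 m, ?_⟩
      rintro _ ⟨a, rfl⟩
      exact Nat.cast_le.mpr (val_seq_le (d := d) e a m)
    refine le_trans ?_ (le_ciSup hb fun j => a.getD j none)
    rw [optSeg, ← h1]
    apply le_of_eq
    congr 2
    apply List.ext_getElem
    · simp [ha]
    · intro i h2 h3
      simp at h2
      simp [seg, h2, ha]

lemma optSeg_le_optSeq {e : ℕ → Request n} (he : FiniteSupport e) (t : ℕ) :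
    (optSeg d e 0 t : ℝ) ≤ optSeq d e := by
  obtain ⟨m, hm⟩ := he
  -- Evaluate the infinite optimum at a horizon that contains the given prefix; an optimal plan for
  -- the prefix is then padded with idle periods.
  rw [optSeq_eq (m := max m t) fun j hj => hm j (le_trans (le_max_left _ _) hj)]
  obtain ⟨k, hk⟩ := Nat.exists_eq_add_of_le (le_max_right m t)
  rw [hk]
  norm_cast
  unfold optSeg
  rw [seg_add]
  obtain ⟨a, ha, h⟩ := exists_val_eq_opt (d := d) (Sys.start n) (seg e 0 t)
  rw [← h]
  have h1 : (seg e 0 t ++ seg e (0 + t) k).zip (a ++ List.replicate k none) =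
      (seg e 0 t).zip a ++ (seg e (0 + t) k).zip (List.replicate k none) :=
    List.zip_append ha.symm
  refine le_trans ?_ (val_le_opt _ _ (a ++ List.replicate k none) (by simp [ha]))
  rw [h1, val_append]
  omega

/-- Number of wrong predictions during `k` periods that begin with period `t`. -/
def wrong (e pred : ℕ → Request n) (t k : ℕ) : ℕ := mismatches (seg e t k) (seg pred t k)

open Classical in
lemma wrong_succ (e pred : ℕ → Request n) (t k : ℕ) :
    wrong e pred t (k + 1) = (if e t = pred t then 0 else 1) + wrong e pred (t + 1) k := by
  simp [wrong, seg_succ, mismatches]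

lemma wrong_zero (e pred : ℕ → Request n) (t : ℕ) : wrong e pred t 0 = 0 := rfl

lemma wrong_add (e pred : ℕ → Request n) (t k m : ℕ) :
    wrong e pred t (k + m) = wrong e pred t k + wrong e pred (t + k) m := by
  induction k generalizing t with
  | zero => simp [wrong_zero]
  | succ k ih =>
    rw [show k + 1 + m = (k + m) + 1 by omega, wrong_succ, wrong_succ, ih,
      show t + 1 + k = t + (k + 1) by omega]
    omega

open Classical in
lemma wrong_one (e pred : ℕ → Request n) (t : ℕ) :
    wrong e pred t 1 = if e t = pred t then 0 else 1 := by
  rw [wrong_succ, wrong_zero, add_zero]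

open Classical in
lemma wrong_eq_sum (e pred : ℕ → Request n) (k : ℕ) :
    wrong e pred 0 k = ∑ j ∈ Finset.range k, if e j = pred j then 0 else 1 := by
  induction k with
  | zero => rfl
  | succ k ih => rw [wrong_add, ih, Finset.sum_range_succ, wrong_one, zero_add]

lemma predError_eq {e pred : ℕ → Request n} {m : ℕ} (he : ∀ j, m ≤ j → e j = emptyRequest n)
    (hp : ∀ j, m ≤ j → pred j = emptyRequest n) : predError e pred = wrong e pred 0 m := by
  classical
  unfold predError
  rw [tsum_eq_sum (s := Finset.range m), wrong_eq_sum]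
  · push_cast
    exact Finset.sum_congr rfl fun j _ => by congr
  · intro j hj
    have : m ≤ j := by simpa using hj
    rw [he j this, hp j this, if_pos rfl]

end Systems

/-! ### Expected reward to go -/

section RewardToGo

variable {n : ℕ} (P : OnlineAlg n) (d : ℕ) (e : ℕ → Request n)

/-- Expected reward during the next `k` periods, beginning in period `t` after the trajectory `h`
with memory `M`. -/
def toGo : ℕ → ℕ → Trajectory n → P.Mem → ℝ
  | 0, _, _, _ => 0
  | k + 1, t, h, M => ex (P.act h M (e t)) fun y =>
      ((sysAfter d h).reward (e t) y.1 : ℝ) + toGo k (t + 1) (h ++ [(e t, y.1)]) y.2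

variable {P}

lemma support_run_finite (hP : ∀ h M r, (P.act h M r).support.Finite) (t : ℕ) :
    (P.run e t).support.Finite := by
  induction t with
  | zero => exact support_pure_finite _
  | succ t ih => exact support_bind_finite ih fun x => support_map_finite (hP _ _ _) _

/-- Reward so far plus expected reward to go is a martingale. This replaces the forward law of the
run by a backward recursion, the form needed for the inductions. -/
lemma ex_run_toGo (hP : ∀ h M r, (P.act h M r).support.Finite) (k t : ℕ) :
    ex (P.run e t) (fun x => (val d (Sys.start n) x.1 : ℝ) + toGo P d e k t x.1 x.2) =
      ex (P.run e (t + k)) fun x => (val d (Sys.start n) x.1 : ℝ) := by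
  induction k generalizing t with
  | zero => simp [toGo]
  | succ k ih =>
    rw [show t + (k + 1) = t + 1 + k by omega, ← ih, OnlineAlg.run,
      ex_bind (support_run_finite e hP t) fun x => support_map_finite (hP _ _ _) _]
    refine ex_congr fun x _ => ?_
    rw [ex_map (hP _ _ _), toGo]
    simp only [val_concat, Nat.cast_add, add_assoc]
    exact ((ex_add (hP _ _ _) _ _).trans (by rw [ex_const (hP _ _ _)])).symm

lemma toReal_valUpTo (hP : ∀ h M r, (P.act h M r).support.Finite) (t : ℕ) :
    (P.valUpTo d e t).toReal = toGo P d e t 0 [] P.first := by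
  have h1 := ex_run_toGo d e hP t 0
  rw [zero_add, OnlineAlg.run, ex_pure] at h1
  unfold OnlineAlg.valUpTo
  rw [toReal_tsum_natCast, ← h1]
  simp [val]

lemma map_fst_of_mem_support_run (t : ℕ) (x : Trajectory n × P.Mem)
    (hx : x ∈ (P.run e t).support) : x.1.map Prod.fst = seg e 0 t := by
  induction t generalizing x with
  | zero =>
    rw [OnlineAlg.run, PMF.mem_support_pure_iff] at hx
    simp [hx]
  | succ t ih =>
    rw [OnlineAlg.run, PMF.mem_support_bind_iff] at hx
    obtain ⟨z, hz, hx⟩ := hx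
    rw [PMF.mem_support_map_iff] at hx
    obtain ⟨y, -, rfl⟩ := hx
    rw [List.map_append, ih z hz, seg_concat]
    simp

lemma valUpTo_le (t : ℕ) : P.valUpTo d e t ≤ (optSeg d e 0 t : ℝ≥0∞) := by
  unfold OnlineAlg.valUpTo
  calc ∑' x, P.run e t x * (val d (Sys.start n) x.1 : ℝ≥0∞)
      ≤ ∑' x, P.run e t x * (optSeg d e 0 t : ℝ≥0∞) := by
        refine ENNReal.tsum_le_tsum fun x => ?_
        by_cases hx : x ∈ (P.run e t).support
        · refine mul_le_mul_right ?_ _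
          rw [Nat.cast_le, optSeg, ← map_fst_of_mem_support_run e t x hx]
          conv_lhs => rw [← List.zip_unzip x.1, List.unzip_eq_map]
          exact val_le_opt _ _ _ (by simp)
        · rw [PMF.mem_support_iff, not_not] at hx
          simp [hx]
    _ = (optSeg d e 0 t : ℝ≥0∞) := by rw [ENNReal.tsum_mul_right, PMF.tsum_coe, one_mul]

variable {e}

lemma iSup_valUpTo_le (he : FiniteSupport e) :
    ⨆ t, P.valUpTo d e t ≤ ENNReal.ofReal (optSeq d e) := by
  refine iSup_le fun t => (valUpTo_le d e t).trans ?_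
  rw [← ENNReal.ofReal_natCast]
  exact ENNReal.ofReal_le_ofReal (optSeg_le_optSeq he t)

lemma optSeq_nonneg : 0 ≤ optSeq d e :=
  Real.iSup_nonneg fun _ => tsum_nonneg fun _ => Nat.cast_nonneg _

lemma valSeq_le_optSeq (he : FiniteSupport e) : P.valSeq d e ≤ optSeq d e :=
  ENNReal.toReal_le_of_le_ofReal (optSeq_nonneg d) (iSup_valUpTo_le d he)

lemma toGo_le_valSeq (hP : ∀ h M r, (P.act h M r).support.Finite) (he : FiniteSupport e) (t : ℕ) :
    toGo P d e t 0 [] P.first ≤ P.valSeq d e := by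
  rw [← toReal_valUpTo d e hP]
  exact ENNReal.toReal_mono (ne_top_of_le_ne_top ENNReal.ofReal_ne_top (iSup_valUpTo_le d he))
    (le_iSup (fun t => P.valUpTo d e t) t)

lemma valSeq_le_of_toGo_le (hP : ∀ h M r, (P.act h M r).support.Finite) {r : ℝ} (hr : 0 ≤ r)
    (h : ∀ t, toGo P d e t 0 [] P.first ≤ r) : P.valSeq d e ≤ r := by
  refine ENNReal.toReal_le_of_le_ofReal hr (iSup_le fun t => ?_)
  rw [ENNReal.le_ofReal_iff_toReal_le _ hr, toReal_valUpTo d e hP]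
  · exact h t
  · exact ne_top_of_le_ne_top (ENNReal.natCast_ne_top _) (valUpTo_le d e t)

end RewardToGo

/-! ### Expected reward of Periodic Re-Ranking -/

section PRR

variable {n d : ℕ}

/-- Expected total reward of the `m`-th policy of the online oracle on the requests `l`, beginning
in system `s`. -/
def prrMean (d m : ℕ) : Sys n → Equiv.Perm (Fin n) → List (Request n) → ℝ
  | _, _, [] => 0
  | s, σ, e :: l => ex (prrStarStep d m s σ e) fun y =>
      (s.reward e y.1 : ℝ) + prrMean d m (s.step d e y.1) y.2 l

lemma support_prrRollout_finite (m : ℕ) (s : Sys n) (σ : Equiv.Perm (Fin n))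
    (l : List (Request n)) : (prrRollout d m s σ l).support.Finite := by
  induction l generalizing s σ with
  | nil => exact support_pure_finite _
  | cons e l ih =>
    exact support_bind_finite (Set.toFinite _) fun y => support_map_finite (ih _ _) _

lemma prrRollout_le_length (m : ℕ) (s : Sys n) (σ : Equiv.Perm (Fin n)) (l : List (Request n))
    (x : ℕ) (hx : x ∈ (prrRollout d m s σ l).support) : x ≤ l.length := by
  induction l generalizing s σ x with
  | nil =>
    rw [prrRollout, PMF.mem_support_pure_iff] at hx
    simp [hx]
  | cons e l ih =>
    rw [prrRollout, PMF.mem_support_bind_iff] at hx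
    obtain ⟨y, -, hx⟩ := hx
    rw [PMF.mem_support_map_iff] at hx
    obtain ⟨r, hr, rfl⟩ := hx
    have h1 := ih _ _ _ hr
    have h2 := s.reward_le_one e y.1
    simp only [List.length_cons]
    omega

lemma ex_prrRollout (m : ℕ) (s : Sys n) (σ : Equiv.Perm (Fin n)) (l : List (Request n)) :
    ex (prrRollout d m s σ l) (fun r => (r : ℝ)) = prrMean d m s σ l := by
  induction l generalizing s σ with
  | nil => simp [prrRollout, prrMean, ex_pure]
  | cons e l ih =>
    rw [prrRollout, prrMean, ex_bind (Set.toFinite _) fun y =>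
      support_map_finite (support_prrRollout_finite _ _ _ _) _]
    refine ex_congr fun y _ => ?_
    have hf := support_prrRollout_finite (d := d) m (s.step d e y.1) y.2 l
    rw [ex_map hf]
    push_cast
    rw [ex_add hf, ex_const hf, ih]

lemma prrMean_nonneg (m : ℕ) (s : Sys n) (σ : Equiv.Perm (Fin n)) (l : List (Request n)) :
    0 ≤ prrMean d m s σ l := by
  induction l generalizing s σ with
  | nil => exact le_rfl
  | cons e l ih => exact ex_nonneg fun y => add_nonneg (Nat.cast_nonneg _) (ih _ _)

lemma prrMean_le_append (m : ℕ) (s : Sys n) (σ : Equiv.Perm (Fin n)) (l l' : List (Request n)) :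
    prrMean d m s σ l ≤ prrMean d m s σ (l ++ l') := by
  induction l generalizing s σ with
  | nil => exact prrMean_nonneg _ _ _ _
  | cons e l ih => exact ex_mono (Set.toFinite _) fun y _ => add_le_add_right (ih _ _) _

lemma prrMean_append_empty (m : ℕ) (s : Sys n) (σ : Equiv.Perm (Fin n)) (l l' : List (Request n))
    (h : ∀ x ∈ l', x = emptyRequest n) : prrMean d m s σ (l ++ l') = prrMean d m s σ l := by
  induction l generalizing s σ with
  | nil =>
    rw [List.nil_append]
    induction l' generalizing s σ with
    | nil => rfl
    | cons e l' ih =>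
      have he : e = emptyRequest n := h e (by simp)
      rw [prrMean, prrMean]
      refine (ex_congr fun y _ => ?_).trans (ex_const (Set.toFinite _) 0)
      rw [he, Sys.reward_emptyRequest, ih (fun x hx => h x (by simp [hx])), prrMean]
      simp
  | cons e l ih => exact ex_congr fun y _ => by rw [← ih]; rfl

/-- The ranking is ignored while idling and redrawn in the first active period. -/
lemma prrMean_rank (m : ℕ) (s : Sys n) (σ τ : Equiv.Perm (Fin n)) (l : List (Request n))
    (h : s.time ≤ prrBegin d m) : prrMean d m s σ l = prrMean d m s τ l := by
  induction l generalizing s with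
  | nil => rfl
  | cons e l ih =>
    rw [prrMean, prrMean]
    rcases h.lt_or_eq with h | h
    · simp only [prrStarStep, h, if_true, ex_pure]
      rw [ih]
      exact h
    · simp only [prrStarStep, h, lt_irrefl, if_false, prrStep, Nat.sub_self, Nat.zero_mod, if_true]

lemma bestRanked_congr {s s' : Sys n} (h : ∀ i, s.wait i = s'.wait i) (σ : Equiv.Perm (Fin n))
    (e : Request n) : bestRanked s σ e = bestRanked s' σ e := by
  unfold bestRanked
  simp only [Sys.canServe_iff, h]

lemma reward_congr {s s' : Sys n} (h : ∀ i, s.wait i = s'.wait i) (e : Request n) (a : Action n) :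
    s.reward e a = s'.reward e a := by
  unfold Sys.reward
  simp only [Sys.canServe_iff, h]

lemma wait_step_congr {s s' : Sys n} (h : ∀ i, s.wait i = s'.wait i) (e : Request n)
    (a : Action n) (i : Fin n) : (s.step d e a).wait i = (s'.step d e a).wait i := by
  rw [Sys.wait_step, Sys.wait_step]
  simp only [Sys.canServe_iff, h]

/-- Once active, the policy sees only the remaining waits and the time since it began, so it is a
time translate of plain Periodic Re-Ranking. -/
lemma prrMean_shift (m : ℕ) (s s' : Sys n) (σ : Equiv.Perm (Fin n)) (l : List (Request n))
    (ht : s.time = s'.time + prrBegin d m) (hw : ∀ i, s.wait i = s'.wait i) :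
    prrMean d m s σ l = prrMean d 0 s' σ l := by
  induction l generalizing s s' σ with
  | nil => rfl
  | cons e l ih =>
    have h0 : prrBegin d 0 = 0 := rfl
    have : prrStarStep d m s σ e = prrStarStep d 0 s' σ e := by
      unfold prrStarStep prrStep
      rw [if_neg (show ¬ s.time < prrBegin d m by omega),
        if_neg (show ¬ s'.time < prrBegin d 0 by omega), ht, h0]
      simp only [bestRanked_congr hw, Nat.add_sub_cancel, Nat.sub_zero]
    rw [prrMean, prrMean, this]
    refine ex_congr fun y _ => ?_
    rw [reward_congr hw, ih _ (s'.step d e y.1) _ _ (wait_step_congr hw _ _)]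
    simp only [Sys.step]
    omega

lemma toGo_prr (e : ℕ → Request n) (k t : ℕ) (h : Trajectory n)
    (σ : (prr n d).Mem) (hh : h.length = t) :
    toGo (prr n d) d e k t h σ = prrMean d 0 (sysAfter d h) σ (seg e t k) := by
  induction k generalizing t h σ with
  | zero => rfl
  | succ k ih =>
    rw [seg_succ, toGo]
    have : (prr n d).act h σ (e t) = prrStarStep d 0 (sysAfter d h) σ (e t) := by
      unfold prrStarStep prr
      simp [prrBegin, sysAfter_time]
    rw [this]
    refine (ex_congr (g := fun y => ((sysAfter d h).reward (e t) y.1 : ℝ) +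
      prrMean d 0 ((sysAfter d h).step d (e t) y.1) y.2 (seg e (t + 1) k)) fun y _ => ?_).trans rfl
    rw [ih (t + 1) _ _ (by simp [hh]), sysAfter_concat]

lemma support_prr_finite (h : Trajectory n) (σ : (prr n d).Mem) (e : Request n) :
    ((prr n d).act h σ e).support.Finite :=
  Set.toFinite (α := Action n × Equiv.Perm (Fin n)) _

lemma etaORRA_le (hd : 1 ≤ d) {e : ℕ → Request n} (he : FiniteSupport e) (h : 0 < optSeq d e) :
    etaORRA ≤ comp d e (prr n d) := by
  refine csInf_le ⟨0, ?_⟩ ⟨n, d, e, hd, he, h, rfl⟩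
  rintro _ ⟨n, d, e, -, -, h, rfl⟩
  exact div_nonneg ENNReal.toReal_nonneg h.le

/-- One instance with positive optimum suffices: a single resource and a single request. The bound
enters the consistency proof through ε < η ≤ 1. -/
lemma etaORRA_le_one : etaORRA ≤ 1 := by
  let e : ℕ → Request 1 := fun t _ => decide (t = 0)
  have he : ∀ j, 1 ≤ j → e j = emptyRequest 1 := by
    intro j hj
    funext i
    simp [e, emptyRequest]
    omega
  have h1 : 0 < optSeq 1 e := by
    rw [optSeq_eq he]
    have h2 : (1 : ℕ) ≤ optSeg 1 e 0 1 := by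
      refine le_trans ?_ (val_le_opt (Sys.start 1) (seg e 0 1) [some 0] (by simp))
      simp [seg, val, Sys.reward, Sys.CanServe, Sys.start, e]
    exact_mod_cast h2
  refine (etaORRA_le le_rfl ⟨1, he⟩ h1).trans ?_
  exact (div_le_one h1).mpr (valSeq_le_optSeq 1 ⟨1, he⟩)

/-- The competitive ratio is defined for infinite sequences; padding `l` with empty requests changes
neither the optimum nor the reward of the policy. -/
lemma mul_opt_le_prrMean_zero (hd : 1 ≤ d) {η : ℝ} (hη : η ≤ etaORRA) (σ : Equiv.Perm (Fin n))
    (l : List (Request n)) :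
    η * opt d (Sys.start n) l ≤ prrMean d 0 (Sys.start n) σ l := by
  let e : ℕ → Request n := fun j => l.getD j (emptyRequest n)
  have he : ∀ j, l.length ≤ j → e j = emptyRequest n := by
    intro j hj
    simp [e, hj]
  have hseg : seg e 0 l.length = l := by
    apply List.ext_getElem
    · simp
    · intro i h1 h2
      simp [seg, e, h2]
  have hopt : optSeq d e = opt d (Sys.start n) l := by rw [optSeq_eq he, optSeg, hseg]
  rw [← hopt]
  rcases (optSeq_nonneg d (e := e)).lt_or_eq with h | h
  · have h1 := hη.trans (etaORRA_le hd ⟨_, he⟩ h)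
    rw [comp, le_div_iff₀ h] at h1
    refine h1.trans (valSeq_le_of_toGo_le d support_prr_finite (prrMean_nonneg _ _ _ _) fun t => ?_)
    refine (toGo_prr e t 0 [] _ rfl).trans_le ?_
    refine (prrMean_rank 0 (Sys.start n) _ σ _ (by simp [Sys.start])).trans_le ?_
    refine (prrMean_le_append 0 _ σ _ (seg e (0 + t) l.length)).trans ?_
    rw [← seg_add, add_comm t, seg_add, hseg, prrMean_append_empty]
    intro x hx
    simp only [seg, List.mem_map] at hx
    obtain ⟨j, -, rfl⟩ := hx
    exact he _ (by omega)
  · rw [← h, mul_zero]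
    exact prrMean_nonneg _ _ _ _

lemma prrMean_idle (m : ℕ) (s : Sys n) (σ : Equiv.Perm (Fin n)) (l l' : List (Request n))
    (h : s.time + l.length ≤ prrBegin d m) :
    ∃ s' : Sys n, s'.time = s.time + l.length ∧ (∀ i, s'.wait i = s.wait i - l.length) ∧
      prrMean d m s σ (l ++ l') = prrMean d m s' σ l' := by
  induction l generalizing s with
  | nil => exact ⟨s, by simp, by simp, rfl⟩
  | cons e l ih =>
    simp only [List.length_cons] at h ⊢
    have ht : (s.step d e none).time = s.time + 1 := rfl
    obtain ⟨s', h1, h2, h3⟩ := ih (s.step d e none) (by omega)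
    refine ⟨s', by omega, fun i => ?_, ?_⟩
    · rw [h2, Sys.wait_step, if_neg (by simp)]
      omega
    · rw [List.cons_append, prrMean, prrStarStep, if_pos (by omega), ex_pure, h3]
      simp [Sys.reward]

/-- Reward that the `m`-th policy of the online oracle forgoes by waiting for all resources. -/
def idleLoss (d m : ℕ) : ℕ := if m = 0 then 0 else d - 1

/-- After d - 1 idle periods every wait has expired, and the skipped requests were worth at most d -
1. At the very beginning there is no need to wait, hence `idleLoss`. -/
lemma mul_opt_sub_le_prrMean (hd : 1 ≤ d) {η : ℝ} (hη0 : 0 ≤ η) (hη : η ≤ etaORRA)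
    {m : ℕ} {h : Trajectory n} (hm : h.length = m) (σ : Equiv.Perm (Fin n))
    (l : List (Request n)) :
    η * ((opt d (Sys.start n) l : ℝ) - idleLoss d m) ≤ prrMean d m (sysAfter d h) σ l := by
  by_cases hm0 : m = 0
  · subst hm0
    obtain rfl := List.length_eq_zero_iff.mp hm
    simpa [idleLoss, sysAfter] using mul_opt_le_prrMean_zero hd hη σ l
  rw [idleLoss, if_neg hm0]
  rcases le_total l.length (d - 1) with hl | hl
  · refine le_trans ?_ (prrMean_nonneg _ _ _ _)
    have h1 : (opt d (Sys.start n) l : ℝ) ≤ (d - 1 : ℕ) := by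
      exact_mod_cast (opt_le_length _ _).trans hl
    exact mul_nonpos_of_nonneg_of_nonpos hη0 (by linarith)
  · have hlen : (l.take (d - 1)).length = d - 1 := by simp [hl]
    obtain ⟨s', h1, h2, h3⟩ := prrMean_idle (d := d) m (sysAfter d h) σ (l.take (d - 1))
      (l.drop (d - 1)) (by rw [hlen, sysAfter_time, prrBegin, if_neg hm0, hm])
    have h4 := opt_append_le hd (Sys.start n) (l.take (d - 1)) (l.drop (d - 1))
    rw [List.take_append_drop] at h3 h4
    have h5 := opt_le_length (d := d) (Sys.start n) (l.take (d - 1))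
    rw [h3, prrMean_shift m s' (Sys.start n)]
    · refine le_trans (mul_le_mul_of_nonneg_left ?_ hη0)
        (mul_opt_le_prrMean_zero hd hη σ (l.drop (d - 1)))
      rw [hlen] at h5
      have : (opt d (Sys.start n) l : ℝ) ≤ (d - 1 : ℕ) + opt d (Sys.start n) (l.drop (d - 1)) := by
        exact_mod_cast h4.trans (Nat.add_le_add_right h5 _)
      linarith
    · rw [h1, sysAfter_time, hlen, hm, prrBegin, if_neg hm0]
      simp [Sys.start]
    · intro i
      have := (sysAfter_reachable hd h).wait_lt i
      rw [h2, Sys.wait_start, hlen]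
      omega

end PRR

/-! ### Averages over a random stopping time -/

/-- Expectation over a stopping time: in period `t` one stops with probability `q t`, with the
outcome `X (t + 1)`; if one never stops during `k` periods, the outcome is `Z`. -/
def stopAvg (q X : ℕ → ℝ) (Z : ℝ) : ℕ → ℕ → ℝ
  | 0, _ => Z
  | k + 1, t => q t * X (t + 1) + (1 - q t) * stopAvg q X Z k (t + 1)

/-- The weights `q` do not depend on the random outcome, so the average over the stopping time is
linear and commutes with the expectation. This is where independence of simulations and actual run
is used. -/
lemma stopAvg_ex {β : Type*} {p : PMF β} (hp : p.support.Finite) (q : ℕ → ℝ) {X : ℕ → ℝ} {Z : ℝ}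
    {X' : β → ℕ → ℝ} {Z' : β → ℝ} (k t : ℕ) (hX : ∀ j, t < j → X j = ex p fun y => X' y j)
    (hZ : Z = ex p Z') : stopAvg q X Z k t = ex p fun y => stopAvg q (X' y) (Z' y) k t := by
  induction k generalizing t with
  | zero => exact hZ
  | succ k ih =>
    simp only [stopAvg]
    rw [ex_add hp, ex_mul_left, ex_mul_left, ih _ fun j hj => hX j (by omega),
      hX (t + 1) (by omega)]

lemma stopAvg_const_add (q X : ℕ → ℝ) (Z r : ℝ) (k t : ℕ) :
    stopAvg q (fun j => r + X j) (r + Z) k t = r + stopAvg q X Z k t := by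
  induction k generalizing t with
  | zero => rfl
  | succ k ih =>
    simp only [stopAvg, ih]
    ring

/-- Verification principle: a submartingale-type bound `B` for one period propagates to the whole
phase. -/
lemma le_stopAvg {q X : ℕ → ℝ} {Z : ℝ} {B : ℕ → ℝ} (k t : ℕ) (hq : ∀ j, q j ≤ 1)
    (hZ : B (t + k) ≤ Z)
    (hB : ∀ j, t ≤ j → j < t + k → B j ≤ q j * X (j + 1) + (1 - q j) * B (j + 1)) :
    B t ≤ stopAvg q X Z k t := by
  induction k generalizing t with
  | zero => exact hZ
  | succ k ih =>
    refine (hB t le_rfl (by omega)).trans ?_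
    have h1 := ih (t + 1) (by rwa [show t + 1 + k = t + (k + 1) by omega])
      fun j h1 h2 => hB j (by omega) (by omega)
    have h2 := mul_le_mul_of_nonneg_left h1 (sub_nonneg.mpr (hq t))
    rw [stopAvg]
    linarith

/-! ### The conservative state -/

section Conservative

variable {n d : ℕ} (I : AdaInput n) (e : ℕ → Request n)

open Classical in
/-- Probability that the mean of `N` simulations of the `m`-th policy of the online oracle on the
requests `l`, beginning in system `s`, reaches the reward threshold. -/
def AdaInput.switchProb (d : ℕ) (I : AdaInput n) (m : ℕ) (s : Sys n) (l : List (Request n))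
    (N : ℕ) : ℝ :=
  ex (iidSum (prrRollout d m s 1 l) N) fun x =>
    if I.rewardThreshold ≤ (x : ℝ) / (N : ℝ) then 1 else 0

open Classical in
lemma AdaInput.conservativeAct_eq (h : Trajectory n) (M : AdaMem n) (r : Request n) :
    I.conservativeAct d h M r =
      (prrStarStep d M.begin_ (sysAfter d h) M.rank r).bind fun y =>
        (iidSum (prrRollout d M.begin_ (sysAfter d (h.take M.begin_)) 1
          ((h.drop M.begin_).map Prod.fst ++ [r])) (I.samples * (h.length + 1) ^ 5)).map fun x : ℕ =>
            if I.rewardThreshold ≤ (x : ℝ) / ((I.samples * (h.length + 1) ^ 5 : ℕ) : ℝ) then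
              (y.1, { M with
                predictive := true, rank := y.2, batchEnd := some (h.length + 1), error := 0 })
            else (y.1, { M with rank := y.2 }) := by
  unfold AdaInput.conservativeAct
  congr 1
  funext y
  -- In the definition the law of the sum is coerced to a law on the reals before it is mapped; here
  -- this coercion is made explicit and removed, so that the map starts from natural numbers.
  change PMF.map _ (PMF.bind _ fun a : ℕ => PMF.pure (a : ℝ)) = _
  rw [PMF.map_bind]
  simp only [PMF.pure_map]
  rfl

lemma support_adaSwitch_finite (h : Trajectory n) (M : (adaSwitch d I).Mem) (r : Request n) :
    ((adaSwitch d I).act h M r).support.Finite := by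
  unfold adaSwitch
  dsimp only
  split_ifs
  · exact support_pure_finite _
  · refine (congrArg (fun p : PMF (Action n × AdaMem n) => p.support.Finite)
      (I.conservativeAct_eq h M r)).mpr ?_
    exact support_bind_finite (Set.toFinite _) fun y =>
      support_map_finite (support_iidSum_finite (support_prrRollout_finite _ _ _ _) _) _

/-- The switching probability `q` stands outside the choice of action because the simulations
restart from the system at the beginning of the phase with their own ranking. -/
lemma toGo_conservative (k t : ℕ) (h : Trajectory n) (M : AdaMem n) (hM : M.predictive = false)
    (hh : h.length = t) (m : ℕ) (hm : M.begin_ = m) {q : ℝ}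
    (hq : q = I.switchProb d m (sysAfter d (h.take m)) ((h.drop m).map Prod.fst ++ [e t])
      (I.samples * (t + 1) ^ 5)) :
    toGo (adaSwitch d I) d e (k + 1) t h M =
      ex (prrStarStep d m (sysAfter d h) M.rank (e t)) fun y =>
        ((sysAfter d h).reward (e t) y.1 : ℝ) +
          (q * toGo (adaSwitch d I) d e k (t + 1) (h ++ [(e t, y.1)])
              { M with predictive := true, rank := y.2, batchEnd := some (t + 1), error := 0 } +
            (1 - q) * toGo (adaSwitch d I) d e k (t + 1) (h ++ [(e t, y.1)])
              { M with rank := y.2 }) := by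
  classical
  subst hm hh
  have hact : (adaSwitch d I).act h M (e h.length) = I.conservativeAct d h M (e h.length) := by
    unfold adaSwitch
    simp [hM]
  have hf := support_iidSum_finite (support_prrRollout_finite (d := d) M.begin_
    (sysAfter d (h.take M.begin_)) 1 ((h.drop M.begin_).map Prod.fst ++ [e h.length]))
    (I.samples * (h.length + 1) ^ 5)
  change ex ((adaSwitch d I).act h M (e h.length)) _ = _
  rw [hact, AdaInput.conservativeAct_eq]
  have hfin : (prrStarStep d M.begin_ (sysAfter d h) M.rank (e h.length)).support.Finite :=
    Set.toFinite _
  refine (ex_bind hfin (fun y => support_map_finite hf _) _).trans ?_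
  refine ex_congr fun y _ => ?_
  refine (ex_map hf _ _).trans ?_
  refine Eq.trans (ex_congr (g := fun x : ℕ => if I.rewardThreshold ≤
      (x : ℝ) / ((I.samples * (h.length + 1) ^ 5 : ℕ) : ℝ) then
        ((sysAfter d h).reward (e h.length) y.1 : ℝ) +
          toGo (adaSwitch d I) d e k (h.length + 1) (h ++ [(e h.length, y.1)])
            { M with predictive := true, rank := y.2, batchEnd := some (h.length + 1), error := 0 }
      else ((sysAfter d h).reward (e h.length) y.1 : ℝ) +
          toGo (adaSwitch d I) d e k (h.length + 1) (h ++ [(e h.length, y.1)])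
            { M with rank := y.2 }) fun x _ => ?_) ?_
  · split_ifs <;> rfl
  · rw [ex_ite hf, hq]
    unfold AdaInput.switchProb
    ring

/-- Unrolling the phase period by period: the trajectory is split into the past `g₀` before the
phase, which determines `q`, and the part `g` inside it, which affects `q` only through the
requests. `F` bounds what follows after the switch. -/
lemma stopAvg_le_toGo {m : ℕ} {g₀ : Trajectory n} (hm : g₀.length = m) {T : ℕ} {F q : ℕ → ℝ}
    (hq : ∀ t, q t = I.switchProb d m (sysAfter d g₀) (seg e m (t + 1 - m))
      (I.samples * (t + 1) ^ 5))
    (hq0 : ∀ t, 0 ≤ q t) (hq1 : ∀ t, q t ≤ 1)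
    (hF : ∀ (k t : ℕ) (h : Trajectory n) (M : AdaMem n), k + t = T → m < t → h.length = t →
      M.predictive = true → M.batchEnd = some t → M.error = 0 →
      F t ≤ toGo (adaSwitch d I) d e k t h M)
    (k t : ℕ) (g : Trajectory n) (M : AdaMem n) (hk : k + t = T) (ht : m ≤ t)
    (hg : g.map Prod.fst = seg e m (t - m)) (hM : M.predictive = false) (hb : M.begin_ = m) :
    stopAvg q
      (fun j => prrMean d m (sysAfter d (g₀ ++ g)) M.rank (seg e t (j - t)) + F j)
      (prrMean d m (sysAfter d (g₀ ++ g)) M.rank (seg e t k)) k t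
      ≤ toGo (adaSwitch d I) d e k t (g₀ ++ g) M := by
  induction k generalizing t g M with
  | zero => simp [stopAvg, toGo, prrMean]
  | succ k ih =>
    have hgl : g.length = t - m := by
      have := congrArg List.length hg
      simpa using this
    have hlen : (g₀ ++ g).length = t := by
      rw [List.length_append, hm, hgl]
      omega
    have hg' : g.map Prod.fst ++ [e t] = seg e m (t + 1 - m) := by
      rw [show t + 1 - m = (t - m) + 1 by omega, seg_concat, hg,
        show m + (t - m) = t by omega]
    have hfin : (prrStarStep d m (sysAfter d (g₀ ++ g)) M.rank (e t)).support.Finite :=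
      Set.toFinite _
    rw [toGo_conservative I e k t (g₀ ++ g) M hM hlen m hb (q := q t)
      (by rw [hq, List.take_left' hm, List.drop_left' hm, hg'])]
    have key : stopAvg q
        (fun j => prrMean d m (sysAfter d (g₀ ++ g)) M.rank (seg e t (j - t)) + F j)
        (prrMean d m (sysAfter d (g₀ ++ g)) M.rank (seg e t (k + 1))) k (t + 1) =
        ex (prrStarStep d m (sysAfter d (g₀ ++ g)) M.rank (e t)) fun y =>
          ((sysAfter d (g₀ ++ g)).reward (e t) y.1 : ℝ) + stopAvg q
            (fun j => prrMean d m (sysAfter d (g₀ ++ (g ++ [(e t, y.1)]))) y.2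
              (seg e (t + 1) (j - (t + 1))) + F j)
            (prrMean d m (sysAfter d (g₀ ++ (g ++ [(e t, y.1)]))) y.2 (seg e (t + 1) k))
            k (t + 1) := by
      simp only [← stopAvg_const_add, ← List.append_assoc, sysAfter_concat]
      refine stopAvg_ex hfin q k (t + 1) (fun j hj => ?_) ?_
      · rw [show j - t = (j - (t + 1)) + 1 by omega, seg_succ, prrMean]
        simp only [← add_assoc]
        rw [ex_add hfin (fun y => _ + _) fun _ => F j, ex_const hfin]
      · rw [seg_succ, prrMean]
    have hX : prrMean d m (sysAfter d (g₀ ++ g)) M.rank (seg e t (t + 1 - t)) =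
        ex (prrStarStep d m (sysAfter d (g₀ ++ g)) M.rank (e t)) fun y =>
          ((sysAfter d (g₀ ++ g)).reward (e t) y.1 : ℝ) := by
      rw [show t + 1 - t = 0 + 1 by omega, seg_succ, prrMean]
      simp [prrMean]
    rw [stopAvg, key, hX]
    have hsum : ∀ a b : Action n × Equiv.Perm (Fin n) → ℝ, ∀ r : ℝ,
        q t * (ex (prrStarStep d m (sysAfter d (g₀ ++ g)) M.rank (e t)) a + r) +
          (1 - q t) * ex (prrStarStep d m (sysAfter d (g₀ ++ g)) M.rank (e t))
            (fun y => a y + b y) =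
        ex (prrStarStep d m (sysAfter d (g₀ ++ g)) M.rank (e t))
          (fun y => a y + (q t * r + (1 - q t) * b y)) := by
      intro a b r
      rw [ex_add hfin, ex_add hfin, ex_add hfin, ex_const hfin, ex_mul_left]
      ring
    rw [hsum]
    refine ex_mono hfin fun y _ => add_le_add_right (add_le_add ?_ ?_) _
    · exact mul_le_mul_of_nonneg_left
        (hF k (t + 1) _ _ (by omega) (by omega)
          (by rw [List.length_append, hlen]; rfl) rfl rfl rfl) (hq0 t)
    · refine mul_le_mul_of_nonneg_left ?_ (sub_nonneg.mpr (hq1 t))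
      rw [List.append_assoc]
      exact ih (t + 1) (g ++ [(e t, y.1)]) { M with rank := y.2 } (by omega) (by omega)
        (by rw [List.map_append, ← hg']; rfl) hM hb

end Conservative

/-! ### Batches of the predictive state -/

section Batch

variable {n d : ℕ} {I : AdaInput n} {e : ℕ → Request n}

lemma AdaInput.horizon_zero (t : ℕ) (r : Request n) : I.horizon t r 0 = [] := rfl

lemma AdaInput.horizon_succ (t : ℕ) (r : Request n) (k : ℕ) :
    I.horizon t r (k + 1) = r :: seg I.pred (t + 1) k := by
  unfold AdaInput.horizon seg
  rw [List.range_succ_eq_map]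
  simp only [List.map_cons, List.map_map, if_true, List.cons.injEq, true_and]
  refine List.map_congr_left fun j _ => ?_
  simp [add_assoc, add_comm 1]

lemma AdaInput.horizon_length (t : ℕ) (r : Request n) (k : ℕ) :
    (I.horizon t r k).length = k := by
  simp [AdaInput.horizon]

lemma AdaInput.horizon_add (t : ℕ) (r : Request n) {k : ℕ} (hk : 1 ≤ k) (i : ℕ) :
    I.horizon t r (k + i) = I.horizon t r k ++ seg I.pred (t + k) i := by
  obtain ⟨k, rfl⟩ := Nat.exists_eq_add_of_le' hk
  rw [show k + 1 + i = k + i + 1 by omega, AdaInput.horizon_succ, AdaInput.horizon_succ, seg_add,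
    show t + 1 + k = t + (k + 1) by omega]
  rfl

lemma mismatches_horizon_le (t k : ℕ) :
    mismatches (seg e t k) (I.horizon t (e t) k) ≤ wrong e I.pred t k := by
  cases k with
  | zero => exact Nat.zero_le _
  | succ k =>
    rw [wrong_succ, seg_succ, AdaInput.horizon_succ]
    simp [mismatches, wrong]

lemma supportLength_spec {e : ℕ → Request n} (he : FiniteSupport e) (j : ℕ)
    (hj : supportLength e ≤ j) : e j = emptyRequest n :=
  Nat.sInf_mem (s := {m | ∀ j, m ≤ j → e j = emptyRequest n}) he j hj

lemma AdaInput.planVal_lt_of_lt (h : Trajectory n) (r : Request n) {i : ℕ}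
    (hi : i < I.batchLength d h r) : (I.planVal d h r i : ℝ) < I.α * I.c := by
  have := Nat.notMem_of_lt_sInf hi
  exact (not_not.mp this).2

lemma AdaInput.batchLength_spec (h : Trajectory n) (r : Request n) :
    ¬ (h.length + I.batchLength d h r + 1 ≤ I.estimateM (h.length + 1) ∧
      (I.planVal d h r (I.batchLength d h r) : ℝ) < I.α * I.c) :=
  Nat.sInf_mem (s := {k | ¬ (h.length + k + 1 ≤ I.estimateM (h.length + 1) ∧
    (I.planVal d h r k : ℝ) < I.α * I.c)})
    ⟨I.estimateM (h.length + 1), fun hk => absurd hk.1 (by omega)⟩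

lemma AdaInput.planVal_zero (h : Trajectory n) (r : Request n) : I.planVal d h r 0 = 0 := by
  simp [AdaInput.planVal, AdaInput.horizon_zero, val]

lemma AdaInput.mul_opt_le_planVal {γ : ℝ} (hA : IsOfflineOracle d γ I.oracle)
    (h : Trajectory n) (r : Request n) (k : ℕ) :
    γ * opt d (sysAfter d h) (I.horizon h.length r k) ≤ I.planVal d h r k := by
  cases k with
  | zero =>
    have : opt d (sysAfter d h) (I.horizon h.length r 0) = 0 := Nat.le_zero.mp (opt_le_length _ _)
    rw [this]
    simp
  | succ k => exact (hA h _ (by simp [AdaInput.horizon_succ])).2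

/-- The first `i` periods in which a plan is executed, beginning in period `t`. -/
def executed (e : ℕ → Request n) (p : ℕ → Action n) (t i : ℕ) : Trajectory n :=
  (List.range i).map fun j => (e (t + j), p (t + j))

lemma executed_succ (e : ℕ → Request n) (p : ℕ → Action n) (t i : ℕ) :
    executed e p t (i + 1) = executed e p t i ++ [(e (t + i), p (t + i))] := by
  simp [executed, List.range_succ]

lemma executed_length (e : ℕ → Request n) (p : ℕ → Action n) (t i : ℕ) :
    (executed e p t i).length = i := by
  simp [executed]

lemma lag_self (s : Sys n) : lag s s = 0 := by
  simp [lag]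

/-- The term `d` pays for resources that are busy at the start of the batch, the error term for
replacing true by predicted requests. -/
lemma optSeg_le_opt_horizon (hd : 1 ≤ d) (h : Trajectory n) {t : ℕ} (ht : h.length = t) (i : ℕ) :
    (optSeg d e t i : ℝ) ≤
      opt d (sysAfter d h) (I.horizon h.length (e t) i) + wrong e I.pred t i + d := by
  subst ht
  have h1 := opt_start_le (sysAfter_reachable hd h) (seg e h.length i)
  have h2 := opt_le_opt (s := sysAfter d h) (sysAfter_reachable hd h) (seg e h.length i)
    (I.horizon h.length (e h.length) i) (by rw [seg_length, AdaInput.horizon_length])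
  have h3 := mismatches_horizon_le (I := I) (e := e) h.length i
  rw [lag_self] at h2
  have : optSeg d e h.length i ≤
      opt d (sysAfter d h) (I.horizon h.length (e h.length) i) + wrong e I.pred h.length i + d := by
    unfold optSeg
    omega
  exact_mod_cast this

/-- While the batch is incomplete, γO ≤ αd for the anticipated optimum O; then γκ(O + d) ≤ καd + κγd
= γαd by the choice of κ. -/
lemma batch_partial (hd : 1 ≤ d) {γ κ : ℝ} (hγ : 0 < γ) (hc : I.c = d)
    (hκ : κ * (I.α + γ) = γ * I.α) (hκ0 : 0 ≤ κ)
    (hA : IsOfflineOracle d γ I.oracle) (hp : FiniteSupport I.pred)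
    (h : Trajectory n) {t : ℕ} (ht : h.length = t) (i : ℕ)
    (hi : ∀ E, (I.newBatch d h (e t)).1 = some E → t + i < E) :
    κ * optSeg d e t i ≤ κ * wrong e I.pred t i + I.α * d := by
  have h1 := optSeg_le_opt_horizon (I := I) (e := e) hd h ht i
  have hd' : (1 : ℝ) ≤ d := by exact_mod_cast hd
  suffices h2 : γ * opt d (sysAfter d h) (I.horizon h.length (e t) i) ≤ I.α * d by
    have h3 : γ * (κ * (opt d (sysAfter d h) (I.horizon h.length (e t) i) + d)) ≤
        γ * (I.α * d) := by
      have h4 := mul_le_mul_of_nonneg_left h2 hκ0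
      have h5 : κ * (I.α * d) + κ * γ * d = γ * (I.α * d) := by
        rw [← mul_assoc γ, ← hκ]; ring
      linarith
    have h6 := le_of_mul_le_mul_left h3 hγ
    have h7 := mul_le_mul_of_nonneg_left h1 hκ0
    linarith
  subst ht
  rw [← hc]
  set k := I.batchLength d h (e h.length) with hk
  by_cases hik : i < k
  · exact (I.mul_opt_le_planVal hA _ _ _).trans (I.planVal_lt_of_lt h _ hik).le
  unfold AdaInput.newBatch at hi
  dsimp only at hi
  rw [← hk] at hi
  split_ifs at hi with hv
  -- Batch without end: the loop stopped at the estimated effective length with too little reward.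
  -- Beyond it the prediction is empty, so the anticipated optimum no longer grows.
  · have h3 := I.batchLength_spec (d := d) h (e h.length)
    rw [← hk] at h3
    have h4 : I.estimateM (h.length + 1) < h.length + k + 1 := by
      by_contra h5
      exact h3 ⟨by omega, hv⟩
    have h5 : h.length + 1 ≤ I.estimateM (h.length + 1) := le_max_left _ _
    have h6 : supportLength I.pred ≤ I.estimateM (h.length + 1) := le_max_right _ _
    obtain ⟨j, rfl⟩ := Nat.exists_eq_add_of_le (not_lt.mp hik)
    rw [AdaInput.horizon_add _ _ (by omega)]
    have h7 := opt_append_le hd (sysAfter d h) (I.horizon h.length (e h.length) k)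
      (seg I.pred (h.length + k) j)
    have h8 : opt d (Sys.start n) (seg I.pred (h.length + k) j) = 0 :=
      optSeg_eq_zero (fun a ha => supportLength_spec hp a (by omega)) j
    rw [h8, add_zero] at h7
    have h9 : (opt d (sysAfter d h) (I.horizon h.length (e h.length) k ++
      seg I.pred (h.length + k) j) : ℝ) ≤ opt d (sysAfter d h) (I.horizon h.length (e h.length) k) := by
      exact_mod_cast h7
    exact (mul_le_mul_of_nonneg_left h9 hγ.le).trans
      ((I.mul_opt_le_planVal hA _ _ _).trans hv.le)
  · have := hi _ rfl
    omega

/-- The planned reward V satisfies V ≥ γO and V ≥ αd; weights κα and κγ turn this into γα·κ(O + d) ≤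
γα·V. Executing the plan on the true requests loses at most one per wrong prediction, which explains
the factor 1 + κ. -/
lemma batch_full (hd : 1 ≤ d) {γ κ : ℝ} (hγ : 0 < γ) (hα : 0 < I.α) (hc : I.c = d)
    (hκ : κ * (I.α + γ) = γ * I.α) (hκ0 : 0 ≤ κ)
    (hA : IsOfflineOracle d γ I.oracle)
    (h : Trajectory n) {t : ℕ} (ht : h.length = t) {i : ℕ}
    (hi : (I.newBatch d h (e t)).1 = some (t + i)) :
    1 ≤ i ∧ κ * optSeg d e t i ≤
      val d (sysAfter d h) (executed e (I.newBatch d h (e t)).2 t i) +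
        (1 + κ) * wrong e I.pred t i := by
  have h1 := optSeg_le_opt_horizon (I := I) (e := e) hd h ht i
  have hd' : (1 : ℝ) ≤ d := by exact_mod_cast hd
  subst ht
  set k := I.batchLength d h (e h.length) with hk
  unfold AdaInput.newBatch at hi ⊢
  dsimp only at hi ⊢
  rw [← hk] at hi ⊢
  split_ifs at hi with hv
  rw [if_neg hv]
  have hki : k = i := by
    have := Option.some.inj hi
    omega
  rw [hki] at hv ⊢
  rw [hc, not_lt] at hv
  have hi1 : 1 ≤ i := by
    by_contra h0
    have : i = 0 := by omega
    rw [this, AdaInput.planVal_zero] at hv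
    have : 0 < I.α * d := by positivity
    norm_num at hv
    linarith
  refine ⟨hi1, ?_⟩
  have hA' := hA h (I.horizon h.length (e h.length) i)
    (by rw [← List.length_pos_iff, AdaInput.horizon_length]; omega)
  have h2 := I.mul_opt_le_planVal hA h (e h.length) i
  have hlen := hA'.1
  rw [AdaInput.horizon_length] at hlen
  have hex : executed e (fun j => (I.oracle h (I.horizon h.length (e h.length) i)).getD
      (j - h.length) none) h.length i =
      (seg e h.length i).zip (I.oracle h (I.horizon h.length (e h.length) i)) := by
    apply List.ext_getElem
    · simp [executed, hlen]
    · intro j h3 h4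
      simp only [executed_length] at h3
      simp [executed, seg, h3, hlen]
  dsimp only
  rw [hex]
  have h3 := val_le_val (s := sysAfter d h) (sysAfter_reachable hd h)
    (I.horizon h.length (e h.length) i) (seg e h.length i)
    (I.oracle h (I.horizon h.length (e h.length) i))
    (by rw [seg_length, AdaInput.horizon_length])
  rw [lag_self, mismatches_comm] at h3
  have h4 := h3.trans (Nat.add_le_add_left (mismatches_horizon_le h.length i) _)
  have h5 : (I.planVal d h (e h.length) i : ℝ) ≤
      val d (sysAfter d h) ((seg e h.length i).zip
        (I.oracle h (I.horizon h.length (e h.length) i))) + wrong e I.pred h.length i := by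
    exact_mod_cast h4
  set V : ℝ := (I.planVal d h (e h.length) i : ℝ) with hV
  set O : ℝ := (opt d (sysAfter d h) (I.horizon h.length (e h.length) i) : ℝ) with hO
  have h6 : (γ * I.α) * (κ * (O + d)) ≤ (γ * I.α) * V := by
    have h7 := mul_le_mul_of_nonneg_left h2 (mul_nonneg hκ0 hα.le)
    have h8 := mul_le_mul_of_nonneg_left hv (mul_nonneg hκ0 hγ.le)
    have h9 : κ * I.α * V + κ * γ * V = (γ * I.α) * V := by
      rw [← hκ]; ring
    linarith
  have h10 := le_of_mul_le_mul_left h6 (by positivity)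
  have h11 := mul_le_mul_of_nonneg_left h1 hκ0
  linarith

end Batch

/-! ### The predictive state -/

section Predictive

variable {n d : ℕ} {I : AdaInput n} {e : ℕ → Request n}

/-- The batch that is executed in the current period. -/
def AdaInput.currentBatch (d : ℕ) (I : AdaInput n) (h : Trajectory n) (M : AdaMem n)
    (r : Request n) : Option ℕ × (ℕ → Action n) :=
  if M.batchEnd = some h.length then I.newBatch d h r else (M.batchEnd, M.plan)

/-- The increase of the cumulative prediction error in period `t`. -/
def AdaInput.errorStep (I : AdaInput n) (e : ℕ → Request n) (t : ℕ) : ℝ :=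
  min (wrong e I.pred t 1 : ℝ) (I.c / I.b)

lemma toGo_predictive (k t : ℕ) (h : Trajectory n) (M : AdaMem n) (hM : M.predictive = true)
    (hh : h.length = t) :
    ∃ M' : AdaMem n, toGo (adaSwitch d I) d e (k + 1) t h M =
        ((sysAfter d h).reward (e t) ((I.currentBatch d h M (e t)).2 t) : ℝ) +
          toGo (adaSwitch d I) d e k (t + 1)
            (h ++ [(e t, (I.currentBatch d h M (e t)).2 t)]) M' ∧
      (I.errorThreshold ≤ M.error + I.errorStep e t → M'.predictive = false ∧ M'.begin_ = t + 1) ∧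
      (M.error + I.errorStep e t < I.errorThreshold → M'.predictive = true ∧
        M'.batchEnd = (I.currentBatch d h M (e t)).1 ∧ M'.plan = (I.currentBatch d h M (e t)).2 ∧
        M'.error = M.error + I.errorStep e t) := by
  classical
  subst hh
  have hact : (adaSwitch d I).act h M (e h.length) =
      PMF.pure (I.predictiveAct d h M (e h.length)) := by
    unfold adaSwitch
    simp [hM]
  have herr : M.error + min (if e h.length = I.pred h.length then 0 else 1) (I.c / I.b) =
      M.error + I.errorStep e h.length := by
    rw [AdaInput.errorStep, wrong_one]
    push_cast
    rfl
  refine ⟨(I.predictiveAct d h M (e h.length)).2, ?_, fun h1 => ?_, fun h1 => ?_⟩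
  · change ex ((adaSwitch d I).act h M (e h.length)) _ = _
    rw [hact]
    refine (ex_pure _ _).trans ?_
    rfl
  · unfold AdaInput.predictiveAct
    dsimp only
    rw [if_pos]
    · exact ⟨rfl, rfl⟩
    · convert h1 using 1
  · unfold AdaInput.predictiveAct
    dsimp only
    rw [if_neg]
    · refine ⟨hM, rfl, rfl, ?_⟩
      rw [← herr]
    · rw [not_le]
      refine Eq.trans_lt ?_ h1
      rw [← herr]

/-- Comparison with the optimum happens only when a batch ends or is cut short, so the induction
carries the reward and the errors since the start of the batch. A batch cut short costs an extra αd,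
charged to `U` by `hU0` at the horizon and by `hU2` at the error threshold. The factor `r` allows a
ratio below κ. -/
lemma le_toGo_of_midbatch (hd : 1 ≤ d) {γ κ r lam : ℝ} (hγ : 0 < γ) (hα : 0 < I.α) (hc : I.c = d)
    (hκ : κ * (I.α + γ) = γ * I.α) (hκ0 : 0 ≤ κ) (hr0 : 0 ≤ r) (hr1 : r ≤ 1) (hlam : lam = r * κ)
    (hA : IsOfflineOracle d γ I.oracle) (hp : FiniteSupport I.pred)
    {T : ℕ} {S : ℕ → ℝ} {U : ℕ → ℝ → ℝ}
    (hU0 : ∀ φ, φ < I.errorThreshold → r * (I.α * d) ≤ U T φ)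
    (hU1 : ∀ t φ, t < T → φ < I.errorThreshold →
      U (t + 1) (φ + I.errorStep e t) + r * ((1 + κ) * wrong e I.pred t 1) ≤ U t φ)
    (hU2 : ∀ t φ, t < T → φ < I.errorThreshold → I.errorThreshold ≤ φ + I.errorStep e t →
      S (t + 1) + r * (I.α * d + (1 + κ) * wrong e I.pred t 1) ≤ U t φ)
    {t₀ : ℕ} {h₀ : Trajectory n} (hh₀ : h₀.length = t₀)
    (hC : ∀ (k t : ℕ) (h : Trajectory n) (M : AdaMem n), k + t = T → t₀ < t → h.length = t →
      M.predictive = false → M.begin_ = t →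
      lam * optSeg d e t k - S t ≤ toGo (adaSwitch d I) d e k t h M)
    (hB : ∀ (k t : ℕ) (h : Trajectory n) (M : AdaMem n), k + t = T → t₀ < t → h.length = t →
      M.predictive = true → M.batchEnd = some t → M.error < I.errorThreshold →
      lam * optSeg d e t k - U t M.error ≤ toGo (adaSwitch d I) d e k t h M)
    {B : Option ℕ × (ℕ → Action n)} (hBdef : I.newBatch d h₀ (e t₀) = B)
    (k i : ℕ) (M : AdaMem n) (hk : k + (t₀ + i) = T) (hM : M.predictive = true)
    (herr : M.error < I.errorThreshold)
    (hcur : I.currentBatch d (h₀ ++ executed e B.2 t₀ i) M (e (t₀ + i)) = B)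
    (hE : ∀ E, B.1 = some E → t₀ + i < E) :
    lam * optSeg d e t₀ (i + k) ≤
      toGo (adaSwitch d I) d e k (t₀ + i) (h₀ ++ executed e B.2 t₀ i) M +
        val d (sysAfter d h₀) (executed e B.2 t₀ i) +
        r * ((1 + κ) * wrong e I.pred t₀ i) + U (t₀ + i) M.error := by
  have hpart : ∀ i, (∀ E, B.1 = some E → t₀ + i < E) →
      κ * optSeg d e t₀ i ≤ κ * wrong e I.pred t₀ i + I.α * d := fun i hi =>
    batch_partial hd hγ hc hκ hκ0 hA hp h₀ hh₀ i (by rw [hBdef]; exact hi)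
  have hfull : ∀ i, B.1 = some (t₀ + i) → κ * optSeg d e t₀ i ≤
      val d (sysAfter d h₀) (executed e B.2 t₀ i) + (1 + κ) * wrong e I.pred t₀ i := by
    intro i hi
    rw [← hBdef] at hi ⊢
    exact (batch_full hd hγ hα hc hκ hκ0 hA h₀ hh₀ hi).2
  induction k generalizing i M with
  | zero =>
    have h1 := mul_le_mul_of_nonneg_left (hpart i hE) hr0
    have h2 := hU0 _ herr
    have h3 : (0 : ℝ) ≤ val d (sysAfter d h₀) (executed e B.2 t₀ i) := Nat.cast_nonneg _
    have h4 : 0 ≤ r * wrong e I.pred t₀ i := mul_nonneg hr0 (Nat.cast_nonneg _)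
    rw [show T = t₀ + i by omega] at h2
    rw [add_zero, hlam]
    change _ ≤ (0 : ℝ) + _ + _ + _
    linarith
  | succ k ih =>
    have hlen : (h₀ ++ executed e B.2 t₀ i).length = t₀ + i := by
      rw [List.length_append, hh₀, executed_length]
    obtain ⟨M', h1, h2, h3⟩ := toGo_predictive (I := I) (e := e) (d := d) k (t₀ + i) _ M hM hlen
    rw [hcur] at h1 h3
    have hval : val d (sysAfter d h₀) (executed e B.2 t₀ (i + 1)) =
        val d (sysAfter d h₀) (executed e B.2 t₀ i) +
          (sysAfter d (h₀ ++ executed e B.2 t₀ i)).reward (e (t₀ + i)) (B.2 (t₀ + i)) := by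
      rw [executed_succ, val_append, sysAfter_append]
      simp [val]
    have hval' : (val d (sysAfter d h₀) (executed e B.2 t₀ (i + 1)) : ℝ) =
        val d (sysAfter d h₀) (executed e B.2 t₀ i) +
          (sysAfter d (h₀ ++ executed e B.2 t₀ i)).reward (e (t₀ + i)) (B.2 (t₀ + i)) := by
      exact_mod_cast hval
    have hw : (wrong e I.pred t₀ (i + 1) : ℝ) =
        wrong e I.pred t₀ i + wrong e I.pred (t₀ + i) 1 := by
      exact_mod_cast wrong_add e I.pred t₀ i 1
    have hsub : (optSeg d e t₀ (i + (k + 1)) : ℝ) ≤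
        optSeg d e t₀ (i + 1) + optSeg d e (t₀ + (i + 1)) k := by
      have := optSeg_add_le hd e t₀ (i + 1) k
      rw [show i + 1 + k = i + (k + 1) by omega] at this
      exact_mod_cast this
    have hlam0 : 0 ≤ lam := hlam ▸ mul_nonneg hr0 hκ0
    have hsub' := mul_le_mul_of_nonneg_left hsub hlam0
    rw [List.append_assoc, ← executed_succ] at h1
    have hlen' : (h₀ ++ executed e B.2 t₀ (i + 1)).length = t₀ + i + 1 := by
      rw [List.length_append, hh₀, executed_length, add_assoc]
    have hV0 : (0 : ℝ) ≤ val d (sysAfter d h₀) (executed e B.2 t₀ (i + 1)) := Nat.cast_nonneg _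
    have hV1 := mul_le_mul_of_nonneg_right hr1 hV0
    have hW0 : 0 ≤ r * wrong e I.pred t₀ (i + 1) := mul_nonneg hr0 (Nat.cast_nonneg _)
    have hαd : 0 ≤ r * (I.α * d) := by positivity
    -- A batch with infinite end falls under the second alternative.
    have hdich : B.1 = some (t₀ + (i + 1)) ∨ ∀ E, B.1 = some E → t₀ + (i + 1) < E := by
      by_cases h : B.1 = some (t₀ + (i + 1))
      · exact Or.inl h
      · refine Or.inr fun E hE' => ?_
        have h5 := hE E hE'
        have h6 : E ≠ t₀ + (i + 1) := fun h6 => h (h6 ▸ hE')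
        omega
    rw [h1]
    rcases le_or_gt I.errorThreshold (M.error + I.errorStep e (t₀ + i)) with hthr | hthr
    · obtain ⟨h4, h5⟩ := h2 hthr
      have h6 := hC k (t₀ + i + 1) _ M' (by omega) (by omega) hlen' h4 h5
      have h7 := hU2 (t₀ + i) M.error (by omega) herr hthr
      rw [show t₀ + i + 1 = t₀ + (i + 1) by omega] at h6 h7 ⊢
      have h8 : lam * optSeg d e t₀ (i + 1) ≤
          val d (sysAfter d h₀) (executed e B.2 t₀ (i + 1)) +
            r * (I.α * d + (1 + κ) * wrong e I.pred t₀ (i + 1)) := by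
        rw [hlam, mul_assoc]
        rcases hdich with h | h
        · have := mul_le_mul_of_nonneg_left (hfull _ h) hr0
          linarith
        · have := mul_le_mul_of_nonneg_left (hpart _ h) hr0
          linarith
      rw [hw] at h8
      linarith
    · obtain ⟨h4, h5, h6, h7⟩ := h3 hthr
      have h8 := hU1 (t₀ + i) M.error (by omega) herr
      rw [show t₀ + i + 1 = t₀ + (i + 1) by omega] at h8 hlen' ⊢
      rcases hdich with h | h
      · have h9 := hB k (t₀ + (i + 1)) _ M' (by omega) (by omega) hlen' h4 (h5.trans h)
          (h7 ▸ hthr)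
        have h10 := mul_le_mul_of_nonneg_left (hfull _ h) hr0
        rw [← mul_assoc, ← hlam, hw] at h10
        rw [h7] at h9
        linarith
      · have h9 := ih (i + 1) M' (by omega) h4 (h7 ▸ hthr) (by
          unfold AdaInput.currentBatch
          rw [if_neg, h5, h6]
          rw [hlen', h5]
          intro h10
          exact absurd (h _ h10) (lt_irrefl _)) h
        rw [show i + 1 + k = i + (k + 1) by omega, hw, h7] at h9
        linarith

/-- A lower bound on the expected reward of AdaSwitch from bounds on the two kinds of phases: `S`
bounds the loss from the start of a conservative phase, and `U` the loss from the start of a batch,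
in dependence on the cumulative prediction error. -/
theorem le_toGo_adaSwitch (hd : 1 ≤ d) {γ κ r lam : ℝ} (hγ : 0 < γ) (hα : 0 < I.α) (hc : I.c = d)
    (hκ : κ * (I.α + γ) = γ * I.α) (hκ0 : 0 ≤ κ) (hr0 : 0 ≤ r) (hr1 : r ≤ 1) (hlam : lam = r * κ)
    (hA : IsOfflineOracle d γ I.oracle) (hp : FiniteSupport I.pred)
    (hthr : 0 < I.errorThreshold) {T : ℕ} {S : ℕ → ℝ} {U : ℕ → ℝ → ℝ}
    (hU0 : ∀ φ, φ < I.errorThreshold → r * (I.α * d) ≤ U T φ)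
    (hU1 : ∀ t φ, t < T → φ < I.errorThreshold →
      U (t + 1) (φ + I.errorStep e t) + r * ((1 + κ) * wrong e I.pred t 1) ≤ U t φ)
    (hU2 : ∀ t φ, t < T → φ < I.errorThreshold → I.errorThreshold ≤ φ + I.errorStep e t →
      S (t + 1) + r * (I.α * d + (1 + κ) * wrong e I.pred t 1) ≤ U t φ)
    (q : ℕ → Trajectory n → ℕ → ℝ)
    (hq : ∀ m g t, q m g t = I.switchProb d m (sysAfter d g) (seg e m (t + 1 - m))
      (I.samples * (t + 1) ^ 5))
    (hq0 : ∀ m g t, 0 ≤ q m g t) (hq1 : ∀ m g t, q m g t ≤ 1)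
    (hcons : ∀ (k m : ℕ) (g : Trajectory n) (σ : Equiv.Perm (Fin n)), k + m = T → g.length = m →
      lam * optSeg d e m k - S m ≤ stopAvg (q m g)
        (fun j => prrMean d m (sysAfter d g) σ (seg e m (j - m)) +
          (lam * optSeg d e j (T - j) - U j 0))
        (prrMean d m (sysAfter d g) σ (seg e m k)) k m) :
    lam * optSeg d e 0 T - S 0 ≤ toGo (adaSwitch d I) d e T 0 [] (adaSwitch d I).first := by
  have main : ∀ k t : ℕ, k + t = T →
      (∀ (h : Trajectory n) (M : AdaMem n), h.length = t → M.predictive = false → M.begin_ = t →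
        lam * optSeg d e t k - S t ≤ toGo (adaSwitch d I) d e k t h M) ∧
      (∀ (h : Trajectory n) (M : AdaMem n), h.length = t → M.predictive = true →
        M.batchEnd = some t → M.error < I.errorThreshold →
        lam * optSeg d e t k - U t M.error ≤ toGo (adaSwitch d I) d e k t h M) := by
    intro k
    induction k using Nat.strong_induction_on with
    | _ k ih =>
      intro t ht
      constructor
      · intro h M hh hM hb
        refine (hcons k t h M.rank ht hh).trans ?_
        have := stopAvg_le_toGo I e hh (T := T) (q := q t h)
          (F := fun j => lam * optSeg d e j (T - j) - U j 0) (hq t h) (hq0 t h) (hq1 t h)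
          (fun k' t' h' M' h1 h2 h3 h4 h5 h6 => by
            have := (ih k' (by omega) t' h1).2 h' M' h3 h4 h5 (h6 ▸ hthr)
            rw [h6] at this
            rw [show T - t' = k' by omega]
            exact this)
          k t [] M ht le_rfl (by simp) hM hb
        simpa using this
      · intro h M hh hM hb herr
        have := le_toGo_of_midbatch (I := I) (e := e) hd hγ hα hc hκ hκ0 hr0 hr1 hlam hA hp hU0
          hU1 hU2 hh
          (fun k' t' h' M' h1 h2 => (ih k' (by omega) t' h1).1 h' M')
          (fun k' t' h' M' h1 h2 => (ih k' (by omega) t' h1).2 h' M') rfl k 0 M ht hM herr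
          (by simp [executed, AdaInput.currentBatch, hb, hh])
          -- A new batch contains at least one period, since the empty plan earns 0 < αd.
          (fun E hE => by
            obtain ⟨i, rfl | hi⟩ : ∃ i, E = t + i ∨ E < t := by
              rcases le_or_gt t E with h1 | h1
              · obtain ⟨i, hi⟩ := Nat.exists_eq_add_of_le h1
                exact ⟨i, Or.inl hi⟩
              · exact ⟨0, Or.inr h1⟩
            · have := (batch_full hd hγ hα hc hκ hκ0 hA h hh hE).1
              omega
            · unfold AdaInput.newBatch at hE
              dsimp only at hE
              split_ifs at hE
              have := Option.some.inj hE
              omega)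
        simp only [executed, List.range_zero, List.map_nil, List.append_nil, val, Nat.cast_zero,
          add_zero, zero_add, wrong_zero, mul_zero] at this
        linarith
  exact (main T 0 (by omega)).1 [] _ rfl rfl rfl

end Predictive

/-! ### Accuracy of the reward estimate -/

section Estimate

variable {n d : ℕ} {I : AdaInput n}

lemma AdaInput.switchProb_nonneg (m : ℕ) (s : Sys n) (l : List (Request n)) (N : ℕ) :
    0 ≤ I.switchProb d m s l N :=
  ex_nonneg fun x => by split_ifs <;> norm_num

lemma AdaInput.switchProb_le_one (m : ℕ) (s : Sys n) (l : List (Request n)) (N : ℕ) :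
    I.switchProb d m s l N ≤ 1 :=
  ex_le_of_le (support_iidSum_finite (support_prrRollout_finite _ _ _ _) _)
    fun x _ => by split_ifs <;> norm_num

lemma AdaInput.switchProb_le (m : ℕ) (s : Sys n) (l : List (Request n)) {N : ℕ} (hN : 0 < N)
    {Δ : ℝ} (hΔ : 0 < Δ) (h : prrMean d m s 1 l ≤ I.rewardThreshold - Δ) :
    I.switchProb d m s l N ≤ (l.length : ℝ) ^ 2 / (N * Δ ^ 2) := by
  classical
  rw [← ex_prrRollout] at h
  refine (le_of_eq ?_).trans (ex_indicator_le (support_prrRollout_finite (d := d) m s 1 l)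
    (prrRollout_le_length m s 1 l) hN hΔ (fun x => I.rewardThreshold ≤ (x : ℝ) / (N : ℝ))
    fun x hx => ?_)
  · unfold AdaInput.switchProb
    exact ex_congr fun x _ => by congr
  · exact le_trans (by linarith) (le_abs_self _)

lemma AdaInput.one_sub_switchProb_le (m : ℕ) (s : Sys n) (l : List (Request n)) {N : ℕ}
    (hN : 0 < N) {Δ : ℝ} (hΔ : 0 < Δ) (h : I.rewardThreshold + Δ ≤ prrMean d m s 1 l) :
    1 - I.switchProb d m s l N ≤ (l.length : ℝ) ^ 2 / (N * Δ ^ 2) := by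
  classical
  rw [← ex_prrRollout] at h
  refine (le_of_eq ?_).trans (ex_indicator_le (support_prrRollout_finite (d := d) m s 1 l)
    (prrRollout_le_length m s 1 l) hN hΔ (fun x => ¬ I.rewardThreshold ≤ (x : ℝ) / (N : ℝ))
    fun x hx => ?_)
  · have hf := support_iidSum_finite (support_prrRollout_finite (d := d) m s 1 l) N
    unfold AdaInput.switchProb
    refine ((ex_sub hf (fun _ => 1) fun x => if I.rewardThreshold ≤ (x : ℝ) / (N : ℝ)
      then 1 else 0).trans (by rw [ex_const hf])).symm.trans ?_
    exact ex_congr fun x _ => by split_ifs <;> norm_num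
  · rw [abs_sub_comm]
    exact le_trans (by linarith) (le_abs_self _)

/-- The sum of `1 / j ^ 3` over `j > t` is at most `cubeTail t`. -/
def cubeTail (t : ℕ) : ℝ := 2 / ((t : ℝ) + 1)

lemma cubeTail_nonneg (t : ℕ) : 0 ≤ cubeTail t := by
  unfold cubeTail
  positivity

lemma cubeTail_succ_le (t : ℕ) : cubeTail (t + 1) ≤ cubeTail t := by
  unfold cubeTail
  push_cast
  gcongr
  linarith

/-- With x = t + 1, a simulated reward is at most x, so the fifth power leaves 1/x^3, and 1/x^3 ≤
2/(x(x+1)), a telescoping difference. -/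
lemma sq_div_le_cubeTail {H : ℕ} (hH : 0 < H) {Δ : ℝ} (hΔ : 0 < Δ) (t : ℕ) {u : ℕ}
    (hu : u ≤ t + 1) :
    (u : ℝ) ^ 2 / ((H * (t + 1) ^ 5 : ℕ) * Δ ^ 2) ≤
      1 / (H * Δ ^ 2) * (cubeTail t - cubeTail (t + 1)) := by
  have hH' : (0 : ℝ) < H := by exact_mod_cast hH
  have hu' : (u : ℝ) ≤ t + 1 := by exact_mod_cast hu
  have hx : (1 : ℝ) ≤ t + 1 := by linarith [(Nat.cast_nonneg t : (0 : ℝ) ≤ t)]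
  have hx0 : (0 : ℝ) < t + 1 := by linarith
  unfold cubeTail
  push_cast
  set x : ℝ := (t : ℝ) + 1
  have h1 : 2 / x - 2 / (x + 1) = 2 / (x * (x + 1)) := by field_simp; ring
  rw [h1]
  calc (u : ℝ) ^ 2 / (H * x ^ 5 * Δ ^ 2) ≤ x ^ 2 / (H * x ^ 5 * Δ ^ 2) := by gcongr
    _ = 1 / (H * Δ ^ 2) * (1 / x ^ 3) := by field_simp
    _ ≤ 1 / (H * Δ ^ 2) * (2 / (x * (x + 1))) := by
      refine mul_le_mul_of_nonneg_left ?_ (by positivity)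
      rw [div_le_div_iff₀ (by positivity) (by positivity)]
      nlinarith [mul_nonneg hx0.le (sub_nonneg.mpr hx), mul_pos hx0 hx0,
        mul_nonneg (mul_pos hx0 hx0).le (sub_nonneg.mpr hx)]

/-- Probability that AdaSwitch leaves in period `t` the conservative phase that began in period `m`
after the trajectory `g`. -/
def AdaInput.leaveProb (d : ℕ) (I : AdaInput n) (e : ℕ → Request n) (m : ℕ) (g : Trajectory n)
    (t : ℕ) : ℝ :=
  I.switchProb d m (sysAfter d g) (seg e m (t + 1 - m)) (I.samples * (t + 1) ^ 5)

variable {e : ℕ → Request n}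

/-- Simulations start with ranking `1`, the real phase with whatever ranking is stored; their means
agree. -/
lemma prrMean_eq_of_start {m : ℕ} {g : Trajectory n} (hg : g.length = m) (σ : Equiv.Perm (Fin n))
    (l : List (Request n)) :
    prrMean d m (sysAfter d g) σ l = prrMean d m (sysAfter d g) 1 l := by
  refine prrMean_rank m _ σ 1 l ?_
  rw [sysAfter_time, hg, prrBegin]
  split_ifs <;> omega

lemma AdaInput.leaveProb_le (hH : 0 < I.samples) {Δ : ℝ} (hΔ : 0 < Δ) {m : ℕ} {g : Trajectory n}
    (hg : g.length = m) (σ : Equiv.Perm (Fin n)) (t : ℕ)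
    (h : prrMean d m (sysAfter d g) σ (seg e m (t + 1 - m)) ≤ I.rewardThreshold - Δ) :
    I.leaveProb d e m g t ≤
      1 / (I.samples * Δ ^ 2) * (cubeTail t - cubeTail (t + 1)) := by
  rw [prrMean_eq_of_start hg] at h
  refine (I.switchProb_le m _ _ (by positivity) hΔ h).trans ?_
  exact sq_div_le_cubeTail hH hΔ t (by rw [seg_length]; omega)

lemma AdaInput.one_sub_leaveProb_le (hH : 0 < I.samples) {Δ : ℝ} (hΔ : 0 < Δ) {m : ℕ}
    {g : Trajectory n} (hg : g.length = m) (σ : Equiv.Perm (Fin n)) (t : ℕ)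
    (h : I.rewardThreshold + Δ ≤ prrMean d m (sysAfter d g) σ (seg e m (t + 1 - m))) :
    1 - I.leaveProb d e m g t ≤
      1 / (I.samples * Δ ^ 2) * (cubeTail t - cubeTail (t + 1)) := by
  rw [prrMean_eq_of_start hg] at h
  refine (I.one_sub_switchProb_le m _ _ (by positivity) hΔ h).trans ?_
  exact sq_div_le_cubeTail hH hΔ t (by rw [seg_length]; omega)

end Estimate

/-! ### Robustness -/

section Bounds

variable {n d : ℕ} {I : AdaInput n} {e : ℕ → Request n}

lemma idleLoss_le (d m : ℕ) (hd : 1 ≤ d) : (idleLoss d m : ℝ) ≤ (d : ℝ) - 1 := by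
  have : idleLoss d m ≤ d - 1 := by
    unfold idleLoss
    split_ifs <;> omega
  have h2 : ((d - 1 : ℕ) : ℝ) = (d : ℝ) - 1 := by
    push_cast [hd]
    ring
  rw [← h2]
  exact_mod_cast this

lemma wrong_one_le (e pred : ℕ → Request n) (t : ℕ) : wrong e pred t 1 ≤ 1 := by
  classical
  rw [wrong_one]
  split_ifs <;> omega

lemma errorStep_le (t : ℕ) : I.errorStep e t ≤ wrong e I.pred t 1 := min_le_left _ _

lemma le_errorStep (hd : 1 ≤ d) (hc : I.c = d) (hb : I.b = 2) (t : ℕ) :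
    (wrong e I.pred t 1 : ℝ) / 2 ≤ I.errorStep e t := by
  have h1 : (wrong e I.pred t 1 : ℝ) ≤ 1 := by exact_mod_cast wrong_one_le e I.pred t
  have h0 : (0 : ℝ) ≤ wrong e I.pred t 1 := Nat.cast_nonneg _
  have h2 : (1 : ℝ) ≤ d := by exact_mod_cast hd
  refine le_min (by linarith) ?_
  rw [hc, hb]
  linarith

lemma errorStep_nonneg (hd : 1 ≤ d) (hc : I.c = d) (hb : I.b = 2) (t : ℕ) :
    0 ≤ I.errorStep e t :=
  le_trans (by positivity) (le_errorStep hd hc hb t)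

lemma mul_optSeg_sub_le_prrMean (hd : 1 ≤ d) {η lam : ℝ} (hlam0 : 0 ≤ lam) (hlam : lam ≤ η)
    (hη : η ≤ etaORRA) {m : ℕ} {g : Trajectory n} (hg : g.length = m) (σ : Equiv.Perm (Fin n))
    (k : ℕ) :
    lam * ((optSeg d e m k : ℝ) - idleLoss d m) ≤ prrMean d m (sysAfter d g) σ (seg e m k) :=
  mul_opt_sub_le_prrMean hd hlam0 (hlam.trans hη) hg σ _

/-- The parameters of AdaSwitch-ORRA satisfy the assumptions of the performance guarantee. -/
structure AdaInput.Admissible (d : ℕ) (I : AdaInput n) : Prop where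
  one_le_d : 1 ≤ d
  c_eq : I.c = d
  b_eq : I.b = 2
  η_le : I.η ≤ etaORRA
  γ_pos : 0 < I.γ
  γ_le : I.γ ≤ 1
  ε_pos : 0 < I.ε
  ε_lt : I.ε < I.η
  α_ge : 3 ≤ I.α
  ratio : I.η - 15 * I.ε / 16 ≤ I.γ * I.α / (I.α + I.γ)
  samples_pos : 0 < I.samples
  isOracle : IsOfflineOracle d I.γ I.oracle
  finite_pred : FiniteSupport I.pred

/-- Competitive ratio of the predictive state if the prediction is correct. -/
def AdaInput.kappa (I : AdaInput n) : ℝ := I.γ * I.α / (I.α + I.γ)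

/-- Competitive ratio that is kept during a conservative and the following predictive phase. -/
def AdaInput.kept (I : AdaInput n) : ℝ := I.η - 15 * I.ε / 16

/-- Margin of error for the estimate of the reward of the online oracle. -/
def AdaInput.margin (I : AdaInput n) : ℝ := I.η * I.α * I.c / I.ε

/-- Scale of the probability of a wrong estimate. -/
def AdaInput.failScale (I : AdaInput n) : ℝ := 1 / (I.samples * I.margin ^ 2)

namespace AdaInput.Admissible

variable (hI : I.Admissible d)
include hI

lemma α_pos : 0 < I.α := by linarith [hI.α_ge]

lemma η_pos : 0 < I.η := hI.ε_pos.trans hI.ε_lt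

lemma one_le_cast : (1 : ℝ) ≤ d := by exact_mod_cast hI.one_le_d

lemma kappa_mul : I.kappa * (I.α + I.γ) = I.γ * I.α :=
  div_mul_cancel₀ _ (by linarith [hI.α_pos, hI.γ_pos])

lemma kappa_pos : 0 < I.kappa :=
  div_pos (mul_pos hI.γ_pos hI.α_pos) (add_pos hI.α_pos hI.γ_pos)

lemma kappa_le_one : I.kappa ≤ 1 := by
  have h1 := hI.γ_pos
  have h2 := hI.α_pos
  rw [AdaInput.kappa, div_le_one (by linarith)]
  nlinarith [hI.γ_le]

lemma kept_pos : 0 < I.kept := by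
  unfold AdaInput.kept
  linarith [hI.ε_pos, hI.ε_lt]

lemma kept_le_η : I.kept ≤ I.η := by
  unfold AdaInput.kept
  linarith [hI.ε_pos]

lemma kept_le_kappa : I.kept ≤ I.kappa := hI.ratio

lemma errorThreshold_eq : I.errorThreshold = I.kappa / I.kept * (5 * I.α * d / 2) := by
  have h1 := hI.kept_pos
  have h2 := hI.α_pos
  have h3 := hI.γ_pos
  have h4 : I.η - 15 / 16 * I.ε = I.kept := by unfold AdaInput.kept; ring
  unfold AdaInput.errorThreshold AdaInput.kappa
  rw [h4, hI.c_eq, hI.b_eq]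
  field_simp

lemma errorThreshold_pos : 0 < I.errorThreshold := by
  have := hI.one_le_cast
  have := hI.kappa_pos
  have := hI.kept_pos
  have := hI.α_pos
  rw [hI.errorThreshold_eq]
  positivity

lemma margin_eq : I.rewardThreshold = 16 * I.margin := by
  have := hI.ε_pos
  unfold AdaInput.rewardThreshold AdaInput.margin
  field_simp

lemma three_le_margin : 3 ≤ I.margin := by
  have h1 := hI.one_le_cast
  have h2 := hI.α_ge
  have h3 := hI.ε_pos
  have h4 := hI.ε_lt
  unfold AdaInput.margin
  rw [le_div_iff₀ h3, hI.c_eq]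
  have h5 : 3 ≤ I.α * d := by nlinarith
  nlinarith

lemma failScale_pos : 0 < I.failScale := by
  have h1 := hI.three_le_margin
  have h2 : (0 : ℝ) < I.samples := by exact_mod_cast hI.samples_pos
  unfold AdaInput.failScale
  positivity

end AdaInput.Admissible

theorem robust_le_toGo (hI : I.Admissible d) (T : ℕ) :
    I.kept * optSeg d e 0 T - 30 * I.α * d * I.failScale ≤
      toGo (adaSwitch d I) d e T 0 [] (adaSwitch d I).first := by
  have hd := hI.one_le_cast
  have hα := hI.α_ge
  have hκ1 := hI.kappa_le_one
  have hκ0 := hI.kappa_pos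
  have hl0 := hI.kept_pos
  have hlκ := hI.kept_le_kappa
  have hΔ := hI.three_le_margin
  have hK := hI.failScale_pos
  set r := I.kept / I.kappa with hr
  have hr0 : 0 < r := div_pos hl0 hκ0
  have hr1 : r ≤ 1 := (div_le_one hκ0).mpr hlκ
  have hrκ : I.kept = r * I.kappa := (div_mul_cancel₀ _ hκ0.ne').symm
  have hrΘ : r * I.errorThreshold = 5 * I.α * d / 2 := by
    rw [hI.errorThreshold_eq, hr]
    field_simp
  -- Largest loss that one switch to the predictive state can cause: idling of the next conservative
  -- phase, wrong predictions, and one unfinished batch. A wrong prediction costs at most 2r and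
  -- raises the error by at least 1/2, hence the factor 4; the added 1 covers the period that
  -- crosses the threshold.
  set A := I.kept * (d - 1) + r * (4 * (I.errorThreshold + 1) + I.α * d) with hA
  have hαd : 3 * (d : ℝ) ≤ I.α * d := by nlinarith
  have hA1 : A ≤ 225 / 16 * (I.α * d) := by
    have h1 : I.kept * (d - 1) ≤ 1 * (d - 1) :=
      mul_le_mul_of_nonneg_right (hlκ.trans hκ1) (by linarith)
    have h2 : r * (4 + I.α * d) ≤ 1 * (4 + I.α * d) :=
      mul_le_mul_of_nonneg_right hr1 (by linarith)
    rw [hA]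
    linarith
  have hA0 : 0 ≤ A := by
    have h1 : 0 ≤ I.kept * ((d : ℝ) - 1) := mul_nonneg hl0.le (by linarith)
    have h2 : 0 ≤ r * (4 + I.α * d) := mul_nonneg hr0.le (by linarith)
    rw [hA]
    linarith
  set E : ℕ → ℝ := fun t => A * I.failScale * cubeTail t with hE
  have hAK : 0 ≤ A * I.failScale := mul_nonneg hA0 hK.le
  have hE0 : ∀ t, 0 ≤ E t := fun t => mul_nonneg hAK (cubeTail_nonneg t)
  have hE1 : ∀ t, E (t + 1) ≤ E t := fun t => mul_le_mul_of_nonneg_left (cubeTail_succ_le t) hAK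
  have hidle : ∀ m, I.kept * idleLoss d m ≤ I.kept * (d - 1) := fun m =>
    mul_le_mul_of_nonneg_left (idleLoss_le d m hI.one_le_d) hl0.le
  have hwκ : ∀ t, (1 + I.kappa) * (wrong e I.pred t 1 : ℝ) ≤ 2 * wrong e I.pred t 1 := fun t =>
    mul_le_mul_of_nonneg_right (by linarith) (Nat.cast_nonneg _)
  have key := le_toGo_adaSwitch (I := I) (e := e) (d := d) (T := T) (lam := I.kept) (r := r)
    (S := fun m => I.kept * idleLoss d m + E m)
    (U := fun t φ => E t + I.kept * (d - 1) +
      r * (4 * (I.errorThreshold + 1 - φ) + I.α * d))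
    hI.one_le_d hI.γ_pos hI.α_pos hI.c_eq hI.kappa_mul hκ0.le hr0.le hr1 hrκ hI.isOracle
    hI.finite_pred hI.errorThreshold_pos ?_ ?_ ?_ (fun m g t => I.leaveProb d e m g t)
    (fun _ _ _ => rfl) (fun _ _ _ => I.switchProb_nonneg _ _ _ _)
    (fun _ _ _ => I.switchProb_le_one _ _ _ _) ?_
  · have h1 : E 0 = 2 * (A * I.failScale) := by
      simp only [hE, cubeTail]
      norm_num
      ring
    have h2 : A * I.failScale ≤ 15 * (I.α * d) * I.failScale :=
      mul_le_mul_of_nonneg_right (by linarith) hK.le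
    have h3 : idleLoss d 0 = 0 := rfl
    simp only [h1, h3, Nat.cast_zero, mul_zero, zero_add] at key
    linarith
  · intro φ hφ
    have h1 : 0 ≤ r * (4 * (I.errorThreshold + 1 - φ)) := mul_nonneg hr0.le (by linarith)
    have h2 := hE0 T
    have h3 : 0 ≤ I.kept * ((d : ℝ) - 1) := mul_nonneg hl0.le (by linarith)
    linarith
  · intro t φ _ _
    have h1 := le_errorStep (I := I) (e := e) hI.one_le_d hI.c_eq hI.b_eq t
    have h2 : r * ((1 + I.kappa) * wrong e I.pred t 1) ≤ r * (4 * I.errorStep e t) :=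
      mul_le_mul_of_nonneg_left (by linarith [hwκ t]) hr0.le
    have h3 := hE1 t
    linarith
  · intro t φ _ hφ _
    have h1 : (wrong e I.pred t 1 : ℝ) ≤ 1 := by exact_mod_cast wrong_one_le e I.pred t
    have h2 : r * ((1 + I.kappa) * wrong e I.pred t 1) ≤
        r * (4 * (I.errorThreshold + 1 - φ)) :=
      mul_le_mul_of_nonneg_left (by linarith [hwκ t]) hr0.le
    have h3 := hE1 t
    have h4 := hidle (t + 1)
    linarith
  · intro k m g σ hk hg
    have hP : ∀ j, I.kept * ((optSeg d e m j : ℝ) - idleLoss d m) ≤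
        prrMean d m (sysAfter d g) σ (seg e m j) := fun j =>
      mul_optSeg_sub_le_prrMean hI.one_le_d hl0.le hI.kept_le_η hI.η_le hg σ j
    have hPη : ∀ j, I.η * ((optSeg d e m j : ℝ) - idleLoss d m) ≤
        prrMean d m (sysAfter d g) σ (seg e m j) := fun j =>
      mul_optSeg_sub_le_prrMean hI.one_le_d hI.η_pos.le le_rfl hI.η_le hg σ j
    have hB := le_stopAvg (q := I.leaveProb d e m g)
      (X := fun j => prrMean d m (sysAfter d g) σ (seg e m (j - m)) +
          (I.kept * optSeg d e j (T - j) - (E j + I.kept * (d - 1) +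
            r * (4 * (I.errorThreshold + 1 - 0) + I.α * d))))
      (Z := prrMean d m (sysAfter d g) σ (seg e m k))
      (B := fun j => I.kept * optSeg d e m k - I.kept * idleLoss d m - E j) k m
      (fun _ => I.switchProb_le_one _ _ _ _) ?_ ?_
    · refine le_trans (le_of_eq ?_) hB
      ring
    · have h1 := hP k
      have h2 := hE0 (m + k)
      linarith
    · intro t ht htk
      have hsub : (optSeg d e m k : ℝ) ≤
          optSeg d e m (t + 1 - m) + optSeg d e (t + 1) (T - (t + 1)) := by
        have := optSeg_add_le hI.one_le_d e m (t + 1 - m) (T - (t + 1))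
        rw [show t + 1 - m + (T - (t + 1)) = k by omega, show m + (t + 1 - m) = t + 1 by omega]
          at this
        exact_mod_cast this
      have hsub' := mul_le_mul_of_nonneg_left hsub hl0.le
      have hq0 : 0 ≤ I.leaveProb d e m g t := I.switchProb_nonneg _ _ _ _
      have hq1 : I.leaveProb d e m g t ≤ 1 := I.switchProb_le_one _ _ _ _
      have h1 := hP (t + 1 - m)
      have h2 := hPη (t + 1 - m)
      have hE1t := hE1 t
      set Pr := prrMean d m (sysAfter d g) σ (seg e m (t + 1 - m)) with hPr
      set q := I.leaveProb d e m g t with hq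
      have hAX : I.kept * (d - 1) + r * (4 * (I.errorThreshold + 1 - 0) + I.α * d) = A := by
        rw [hA, sub_zero]
      -- Below 15 margins a switch is premature: it may cost A, but its probability is paid by the
      -- decrease of `E`. Above, the surplus of ratio η over the kept ratio is at least
      -- (15ε/16)(15·margin)/η = (225/16)αd ≥ A.
      rcases le_or_gt Pr (I.rewardThreshold - I.margin) with h | h
      · have h3 : q ≤ I.failScale * (cubeTail t - cubeTail (t + 1)) :=
          I.leaveProb_le hI.samples_pos (by linarith) hg σ t h
        have h4 : A * q ≤ E t - E (t + 1) := by
          have := mul_le_mul_of_nonneg_left h3 hA0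
          simp only [hE]
          linarith
        have h5 := mul_le_mul_of_nonneg_left (show
          I.kept * optSeg d e m k - I.kept * idleLoss d m - E (t + 1) - A ≤
            Pr + (I.kept * optSeg d e (t + 1) (T - (t + 1)) - (E (t + 1) + I.kept * (d - 1) +
              r * (4 * (I.errorThreshold + 1 - 0) + I.α * d))) by linarith) hq0
        linarith
      · have h6 : I.kept * (optSeg d e m (t + 1 - m) - idleLoss d m) + 225 / 16 * (I.α * d) ≤
            Pr := by
          have hη := hI.η_pos
          have hε := hI.ε_pos
          rw [hI.margin_eq] at h
          have h7 : I.kept * I.η + 15 * I.ε / 16 * I.η = I.η * I.η := by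
            unfold AdaInput.kept; ring
          have h8 : 15 * I.ε / 16 * (15 * I.margin) = I.η * (225 / 16 * (I.α * d)) := by
            unfold AdaInput.margin
            rw [hI.c_eq]
            field_simp
            ring
          have h9 := mul_le_mul_of_nonneg_left h2 hl0.le
          have h10 : 15 * I.ε / 16 * (15 * I.margin) ≤ 15 * I.ε / 16 * Pr :=
            mul_le_mul_of_nonneg_left (by linarith) (by linarith)
          have h11 : I.kept * Pr + 15 * I.ε / 16 * Pr = I.η * Pr := by
            unfold AdaInput.kept; ring
          have h12 : I.η * (I.kept * (optSeg d e m (t + 1 - m) - idleLoss d m) +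
              225 / 16 * (I.α * d)) ≤ I.η * Pr := by linarith
          exact le_of_mul_le_mul_left h12 hη
        have h5 := mul_le_mul_of_nonneg_left (show
          I.kept * optSeg d e m k - I.kept * idleLoss d m - E (t + 1) ≤
            Pr + (I.kept * optSeg d e (t + 1) (T - (t + 1)) - (E (t + 1) + I.kept * (d - 1) +
              r * (4 * (I.errorThreshold + 1 - 0) + I.α * d))) by linarith) hq0
        linarith

/-! ### Consistency -/

/-- Loss that is paid for a wrong prediction. -/
def AdaInput.price (I : AdaInput n) : ℝ := 14 * I.η / (I.γ * I.ε)

theorem consistent_le_toGo (hI : I.Admissible d) (T : ℕ) :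
    I.kappa * optSeg d e 0 T - 17 * I.α * d / I.ε - 2 * I.failScale -
        I.price * wrong e I.pred 0 T ≤
      toGo (adaSwitch d I) d e T 0 [] (adaSwitch d I).first := by
  have hd := hI.one_le_cast
  have hα := hI.α_ge
  have hκ1 := hI.kappa_le_one
  have hκ0 := hI.kappa_pos
  have hl0 := hI.kept_pos
  have hlη := hI.kept_le_η
  have hΔ := hI.three_le_margin
  have hK := hI.failScale_pos
  have hη := hI.η_pos
  have hε := hI.ε_pos
  have hεη := hI.ε_lt
  have hγ := hI.γ_pos
  have hη1 : I.η ≤ 1 := hI.η_le.trans etaORRA_le_one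
  have hαd : 3 * (d : ℝ) ≤ I.α * d := by nlinarith
  set Q := I.price with hQ
  have hQ14 : 14 ≤ Q := by
    rw [hQ, AdaInput.price, le_div_iff₀ (mul_pos hγ hε)]
    nlinarith [hI.γ_le]
  -- Largest shortfall of Periodic Re-Ranking against κ times the optimum as long as its mean reward
  -- is at most 17 margins: the optimum is then at most L + d, because ηL equals 17 margins.
  set G := max 0 (I.kappa - I.η) * (17 * I.α * d / I.ε) + d with hG
  set L := 17 * I.α * d / I.ε with hL
  have hLε : L * I.ε = 17 * (I.α * d) := by
    rw [hL, div_mul_cancel₀ _ hε.ne']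
    ring
  have hL1 : 17 * (I.α * d) ≤ L := by
    rw [hL, le_div_iff₀ hε]
    nlinarith
  have hG0 : 0 ≤ G := by
    have : 0 ≤ max 0 (I.kappa - I.η) * L := mul_nonneg (le_max_left _ _) (by linarith)
    linarith
  have hBC : I.α * d + G + 1 ≤ L := by
    rcases le_total (I.kappa - I.η) 0 with h | h
    · rw [hG, max_eq_left h]
      linarith
    · have h1 : (I.kappa - I.η) * L ≤ (1 - I.ε) * L :=
        mul_le_mul_of_nonneg_right (by linarith) (by linarith)
      rw [hG, max_eq_right h]
      linarith
  -- Of the price Q, 2 units cover the wrong prediction itself and Q - 2 are saved. At the error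
  -- threshold the savings reach L, which by `hBC` pays for a conservative phase; the constants give
  -- 3/4 · 30 ≥ 17.
  have hQΘ : L ≤ (Q - 2) * I.errorThreshold := by
    have h1 : 3 / 4 * I.γ ≤ I.kappa := by
      unfold AdaInput.kappa
      rw [le_div_iff₀ (by linarith)]
      nlinarith [hI.γ_le]
    have h2 : 12 / 14 * Q ≤ Q - 2 := by linarith
    have h3 : L ≤ 12 / 14 * Q * I.errorThreshold := by
      have h4 : 12 / 14 * Q * I.errorThreshold =
          (I.η * I.kappa) / (I.kept * I.γ) * (30 * (I.α * d) / I.ε) := by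
        rw [hQ, AdaInput.price, hI.errorThreshold_eq]
        field_simp
        ring
      have h5 : 3 / 4 ≤ (I.η * I.kappa) / (I.kept * I.γ) := by
        rw [le_div_iff₀ (mul_pos hl0 hγ)]
        have h6 := mul_le_mul_of_nonneg_left h1 hη.le
        have h7 := mul_le_mul_of_nonneg_right hlη hγ.le
        linarith
      rw [h4]
      have h8 : 0 ≤ 30 * (I.α * d) / I.ε := by
        have : 0 ≤ I.α * d := by linarith
        positivity
      have h9 := mul_le_mul_of_nonneg_right h5 h8
      have h10 : 3 / 4 * (30 * (I.α * d) / I.ε) = 45 / 34 * L := by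
        rw [hL]; field_simp; ring
      have h11 : 0 ≤ L := by linarith
      linarith
    exact h3.trans (mul_le_mul_of_nonneg_right h2 hI.errorThreshold_pos.le)
  set E : ℕ → ℝ := fun t => I.failScale * cubeTail t with hE
  have hE0 : ∀ t, 0 ≤ E t := fun t => mul_nonneg hK.le (cubeTail_nonneg t)
  have hE1 : ∀ t, E (t + 1) ≤ E t := fun t => mul_le_mul_of_nonneg_left (cubeTail_succ_le t) hK.le
  have hwκ : ∀ t, (1 + I.kappa) * (wrong e I.pred t 1 : ℝ) ≤ 2 * wrong e I.pred t 1 := fun t =>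
    mul_le_mul_of_nonneg_right (by linarith) (Nat.cast_nonneg _)
  have hws : ∀ t, t < T → (wrong e I.pred t (T - t) : ℝ) =
      wrong e I.pred t 1 + wrong e I.pred (t + 1) (T - (t + 1)) := fun t ht => by
    have := wrong_add e I.pred t 1 (T - (t + 1))
    rw [show 1 + (T - (t + 1)) = T - t by omega] at this
    exact_mod_cast this
  have key := le_toGo_adaSwitch (I := I) (e := e) (d := d) (T := T) (lam := I.kappa) (r := 1)
    (S := fun m => I.α * d + G + 1 + E m + Q * wrong e I.pred m (T - m))
    -- All future errors are charged in advance, and the last term refers to savings already made.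
    -- The truncation at 0 is needed because the hypotheses on `U` range over all real φ.
    (U := fun t φ => I.α * d + E t + Q * wrong e I.pred t (T - t) + (Q - 2) * max φ 0)
    hI.one_le_d hI.γ_pos hI.α_pos hI.c_eq hI.kappa_mul hκ0.le zero_le_one le_rfl
    (one_mul _).symm hI.isOracle
    hI.finite_pred hI.errorThreshold_pos ?_ ?_ ?_ (fun m g t => I.leaveProb d e m g t)
    (fun _ _ _ => rfl) (fun _ _ _ => I.switchProb_nonneg _ _ _ _)
    (fun _ _ _ => I.switchProb_le_one _ _ _ _) ?_
  · have h1 : E 0 = 2 * I.failScale := by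
      simp only [hE, cubeTail]
      norm_num
      ring
    simp only [h1, Nat.sub_zero] at key
    linarith
  · intro φ _
    have h1 := hE0 T
    have h2 : 0 ≤ (Q - 2) * max φ 0 := mul_nonneg (by linarith) (le_max_right _ _)
    rw [Nat.sub_self, wrong_zero]
    simp only [Nat.cast_zero, mul_zero]
    linarith
  · intro t φ ht _
    have h1 := errorStep_le (I := I) (e := e) t
    have h2 := errorStep_nonneg (I := I) (e := e) hI.one_le_d hI.c_eq hI.b_eq t
    have h3 : max (φ + I.errorStep e t) 0 ≤ max φ 0 + wrong e I.pred t 1 :=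
      max_le (by linarith [le_max_left φ 0]) (by linarith [le_max_right φ 0])
    have h4 := mul_le_mul_of_nonneg_left h3 (show 0 ≤ Q - 2 by linarith)
    have h5 := hE1 t
    have h6 := hwκ t
    simp only [hws t ht]
    linarith
  · intro t φ ht _ hφ
    have h1 := errorStep_le (I := I) (e := e) t
    have h3 : I.errorThreshold ≤ max φ 0 + wrong e I.pred t 1 := by
      linarith [le_max_left φ 0]
    have h4 := mul_le_mul_of_nonneg_left h3 (show 0 ≤ Q - 2 by linarith)
    have h5 := hE1 t
    have h6 := hwκ t
    simp only [hws t ht]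
    linarith
  · intro k m g σ hk hg
    set Pr : ℕ → ℝ := fun j => prrMean d m (sysAfter d g) σ (seg e m (j - m)) with hPr
    have hPη : ∀ j, I.η * ((optSeg d e m (j - m) : ℝ) - d) ≤ Pr j := fun j => by
      have h1 := mul_optSeg_sub_le_prrMean (e := e) hI.one_le_d hη.le le_rfl hI.η_le hg σ (j - m)
      have h2 := mul_le_mul_of_nonneg_left (idleLoss_le d m hI.one_le_d) hη.le
      simp only [hPr]
      linarith
    have hP0 : ∀ j, 0 ≤ Pr j := fun j => prrMean_nonneg _ _ _ _
    have hPmono : ∀ j, m ≤ j → Pr j ≤ Pr (j + 1) := fun j hj => by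
      simp only [hPr]
      rw [show j + 1 - m = j - m + 1 by omega, seg_concat]
      exact prrMean_le_append _ _ _ _ _
    have hGle : ∀ j, Pr j ≤ 17 * I.margin → I.kappa * optSeg d e m (j - m) - Pr j ≤ G := by
      intro j hj
      have h1 := hPη j
      have h2 := hP0 j
      set x : ℝ := (optSeg d e m (j - m) : ℝ) - d with hx
      have hx' : (optSeg d e m (j - m) : ℝ) = x + d := by rw [hx]; ring
      have hκd : I.kappa * d ≤ 1 * d := mul_le_mul_of_nonneg_right hκ1 (by linarith)
      rw [hx', mul_add]
      have h0 : I.kappa * x ≤ Pr j + max 0 (I.kappa - I.η) * L := by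
        rcases le_total x 0 with h | h
        · have h3 := mul_nonpos_of_nonneg_of_nonpos hκ0.le h
          have h4 : 0 ≤ max 0 (I.kappa - I.η) * L :=
            mul_nonneg (le_max_left _ _) (by linarith)
          linarith
        · have h3 : x ≤ L := by
            have h4 : I.η * L = 17 * I.margin := by
              rw [hL, AdaInput.margin, hI.c_eq]
              field_simp
            have h5 : I.η * x ≤ I.η * L := by linarith
            exact le_of_mul_le_mul_left h5 hη
          have h6 : (I.kappa - I.η) * x ≤ max 0 (I.kappa - I.η) * x :=
            mul_le_mul_of_nonneg_right (le_max_right _ _) h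
          have h7 : max 0 (I.kappa - I.η) * x ≤ max 0 (I.kappa - I.η) * L :=
            mul_le_mul_of_nonneg_left h3 (le_max_left _ _)
          linarith
      linarith
    set gap : ℕ → ℝ := fun j => max G (I.kappa * optSeg d e m (j - m) - Pr j) with hgap
    have hTm : T - m = k := by omega
    have hB := le_stopAvg (q := I.leaveProb d e m g)
      (X := fun j => Pr j + (I.kappa * optSeg d e j (T - j) - (I.α * d + E j +
          Q * wrong e I.pred j (T - j) + (Q - 2) * max 0 0)))
      (Z := prrMean d m (sysAfter d g) σ (seg e m k))
      -- The extra 1 is a reserve that is released on leaving the phase and pays for the growth of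
      -- the gap in that period.
      (B := fun j => I.kappa * optSeg d e m k - I.α * d - Q * wrong e I.pred m k - E j -
        (gap j + 1)) k m (fun _ => I.switchProb_le_one _ _ _ _) ?_ ?_
    · refine le_trans (le_of_eq ?_) hB
      have h1 : gap m = G := by
        simp only [hgap, hPr, Nat.sub_self, optSeg_zero, seg_zero, prrMean]
        rw [max_eq_left]
        simpa using hG0
      simp only [h1, hTm]
      ring
    · have h1 : I.kappa * optSeg d e m k - prrMean d m (sysAfter d g) σ (seg e m k) ≤
          gap (m + k) := by
        have := le_max_right G (I.kappa * optSeg d e m (m + k - m) - Pr (m + k))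
        simp only [hPr] at this
        rw [Nat.add_sub_cancel_left] at this
        simp only [hgap, hPr, Nat.add_sub_cancel_left]
        exact this
      have h2 := hE0 (m + k)
      have h3 : 0 ≤ Q * wrong e I.pred m k := mul_nonneg (by linarith) (Nat.cast_nonneg _)
      linarith
    · intro t ht htk
      have hsub : (optSeg d e m k : ℝ) ≤
          optSeg d e m (t + 1 - m) + optSeg d e (t + 1) (T - (t + 1)) := by
        have := optSeg_add_le hI.one_le_d e m (t + 1 - m) (T - (t + 1))
        rw [show t + 1 - m + (T - (t + 1)) = k by omega, show m + (t + 1 - m) = t + 1 by omega]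
          at this
        exact_mod_cast this
      have hsub' := mul_le_mul_of_nonneg_left hsub hκ0.le
      have hwr : (wrong e I.pred (t + 1) (T - (t + 1)) : ℝ) ≤ wrong e I.pred m k := by
        have := wrong_add e I.pred m (t + 1 - m) (T - (t + 1))
        rw [show t + 1 - m + (T - (t + 1)) = k by omega, show m + (t + 1 - m) = t + 1 by omega]
          at this
        exact_mod_cast (by omega :
          wrong e I.pred (t + 1) (T - (t + 1)) ≤ wrong e I.pred m k)
      have hwr' := mul_le_mul_of_nonneg_left hwr (show 0 ≤ Q by linarith)
      have hq0 : 0 ≤ I.leaveProb d e m g t := I.switchProb_nonneg _ _ _ _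
      have hq1 : I.leaveProb d e m g t ≤ 1 := I.switchProb_le_one _ _ _ _
      have hE1t := hE1 t
      have hgr : I.kappa * optSeg d e m (t + 1 - m) - Pr (t + 1) ≤ gap (t + 1) := le_max_right _ _
      have hgG : G ≤ gap t := le_max_left _ _
      have hgap1 : gap (t + 1) + (1 - I.leaveProb d e m g t) ≤ gap t + 1 + (E t - E (t + 1)) := by
        -- Up to 17 margins the gap equals G. Beyond, it may grow by one per period, but the mean
        -- then exceeds the threshold of 16 margins by a full margin, so staying in the phase is
        -- improbable.
        rcases le_or_gt (Pr (t + 1)) (17 * I.margin) with h | h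
        · have h1 : gap (t + 1) = G := max_eq_left (hGle _ h)
          rw [h1]
          linarith
        · have h1 : 1 - I.leaveProb d e m g t ≤
              I.failScale * (cubeTail t - cubeTail (t + 1)) := by
            refine I.one_sub_leaveProb_le hI.samples_pos (by linarith) hg σ t ?_
            rw [hI.margin_eq]
            simp only [hPr] at h
            linarith
          have h2 : gap (t + 1) ≤ gap t + 1 := by
            refine max_le (by linarith) ?_
            have h3 := hPmono t ht
            have h4 : (optSeg d e m (t + 1 - m) : ℝ) ≤ optSeg d e m (t - m) + 1 := by
              have h5 := optSeg_add_le hI.one_le_d e m (t - m) 1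
              have h6 := optSeg_le (d := d) e (m + (t - m)) 1
              rw [show t - m + 1 = t + 1 - m by omega] at h5
              exact_mod_cast h5.trans (Nat.add_le_add_left h6 _)
            have h7 := mul_le_mul_of_nonneg_left h4 hκ0.le
            have h8 : I.kappa * optSeg d e m (t - m) - Pr t ≤ gap t := le_max_right _ _
            linarith
          simp only [hE]
          linarith
      have h5 := mul_le_mul_of_nonneg_left (show
        I.kappa * optSeg d e m k - I.α * d - Q * wrong e I.pred m k - E (t + 1) - gap (t + 1) ≤
          Pr (t + 1) + (I.kappa * optSeg d e (t + 1) (T - (t + 1)) - (I.α * d + E (t + 1) +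
            Q * wrong e I.pred (t + 1) (T - (t + 1)) + (Q - 2) * max 0 0)) by
          rw [max_self, mul_zero]
          linarith) hq0
      linarith

end Bounds

/-! ### Absorbing the simulation errors, and the competitive ratio -/

lemma failScale_mul_le {n d : ℕ} {I : AdaInput n} (hI : I.Admissible d)
    (hH : 100 * (I.η * I.α * d / I.ε ^ 2) ≤ (I.samples : ℝ)) :
    30 * I.α * d * I.failScale ≤ I.ε / 16 := by
  have hd := hI.one_le_cast
  have hα := hI.α_ge
  have hε := hI.ε_pos
  have hη := hI.η_pos
  have hm := hI.three_le_margin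
  have hH' : (0 : ℝ) < I.samples := by exact_mod_cast hI.samples_pos
  -- The constant 100 comes from here: αd ≥ 3 yields 900/16 ≥ 30.
  have h1 : 900 ≤ 100 * (I.α * d) ^ 2 := by
    have : 3 ≤ I.α * d := by nlinarith
    nlinarith
  have h2 : I.ε ^ 3 ≤ I.η ^ 3 := pow_le_pow_left₀ hε.le hI.ε_lt.le 3
  unfold AdaInput.failScale
  rw [mul_one_div, div_le_iff₀ (by positivity)]
  have h3 : I.ε / 16 * (100 * (I.η * I.α * d / I.ε ^ 2) * I.margin ^ 2) ≤
      I.ε / 16 * (I.samples * I.margin ^ 2) := by gcongr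
  refine le_trans ?_ h3
  have h4 : I.ε / 16 * (100 * (I.η * I.α * d / I.ε ^ 2) * I.margin ^ 2) =
      (100 * (I.α * d) ^ 2) * (I.η ^ 3 / I.ε ^ 3) * (I.α * d) / 16 := by
    unfold AdaInput.margin
    rw [hI.c_eq]
    field_simp
  have h5 : 1 ≤ I.η ^ 3 / I.ε ^ 3 := (one_le_div (by positivity)).mpr h2
  have h6 : 900 * 1 ≤ (100 * (I.α * d) ^ 2) * (I.η ^ 3 / I.ε ^ 3) :=
    mul_le_mul h1 h5 zero_le_one (by positivity)
  have h7 : 0 ≤ I.α * d := by positivity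
  have h8 := mul_le_mul_of_nonneg_right h6 h7
  rw [h4]
  linarith

lemma two_failScale_le {n d : ℕ} {I : AdaInput n} (hI : I.Admissible d) :
    2 * I.failScale ≤ I.α * d / I.ε := by
  have hd := hI.one_le_cast
  have hα := hI.α_ge
  have hε := hI.ε_pos
  have hm := hI.three_le_margin
  have hε1 : I.ε ≤ 1 := hI.ε_lt.le.trans (hI.η_le.trans etaORRA_le_one)
  have hH : (1 : ℝ) ≤ I.samples := by exact_mod_cast hI.samples_pos
  have h1 : I.failScale ≤ 1 := by
    unfold AdaInput.failScale
    rw [div_le_one (by positivity)]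
    nlinarith
  rw [le_div_iff₀ hε]
  nlinarith [hI.failScale_pos]

/-- Clearing denominators reduces this to γ(α² - γ²) ≤ γα². -/
lemma sub_sq_div_le_kappa {n d : ℕ} {I : AdaInput n} (hI : I.Admissible d) :
    I.γ - I.γ ^ 2 / I.α ≤ I.kappa := by
  have hα := hI.α_pos
  have hγ := hI.γ_pos
  have h1 : I.γ - I.γ ^ 2 / I.α = I.γ * (I.α - I.γ) / I.α := by field_simp
  unfold AdaInput.kappa
  rw [h1, div_le_div_iff₀ hα (by linarith)]
  have : 0 ≤ I.γ * I.γ ^ 2 := by positivity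
  nlinarith

theorem le_comp_adaSwitch {n d : ℕ} {I : AdaInput n} {e : ℕ → Request n} (hI : I.Admissible d)
    (hH : 100 * (I.η * I.α * d / I.ε ^ 2) ≤ (I.samples : ℝ)) (he : FiniteSupport e)
    (hopt : 0 < optSeq d e) :
    max (I.η - I.ε) (I.γ - I.γ ^ 2 / I.α -
        (18 * I.α * d + 14 * I.η * predError e I.pred / I.γ) / (I.ε * optSeq d e)) ≤
      comp d e (adaSwitch d I) := by
  obtain ⟨m₁, hm₁⟩ := he
  obtain ⟨m₂, hm₂⟩ := hI.finite_pred
  have h1 : ∀ j, max m₁ m₂ ≤ j → e j = emptyRequest n := fun j hj =>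
    hm₁ j ((le_max_left _ _).trans hj)
  have h2 : ∀ j, max m₁ m₂ ≤ j → I.pred j = emptyRequest n := fun j hj =>
    hm₂ j ((le_max_right _ _).trans hj)
  have hval := toGo_le_valSeq (P := adaSwitch d I) d (support_adaSwitch_finite I) ⟨m₁, hm₁⟩
    (max m₁ m₂)
  have hrob := (robust_le_toGo (e := e) hI (max m₁ m₂)).trans hval
  have hcon := (consistent_le_toGo (e := e) hI (max m₁ m₂)).trans hval
  have hε := hI.ε_pos
  have hγ := hI.γ_pos
  have hO : optSeq d e = (optSeg d e 0 (max m₁ m₂) : ℝ) := optSeq_eq h1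
  -- The optimum is a positive integer, so the additive loss ε/16 of the robustness bound is at most
  -- ε/16 times the optimum, which lowers η - 15ε/16 to η - ε.
  have hO1 : 1 ≤ optSeq d e := by
    rw [hO] at hopt ⊢
    exact_mod_cast Nat.succ_le_of_lt (by exact_mod_cast hopt)
  rw [← hO] at hrob hcon
  rw [← predError_eq h1 h2] at hcon
  unfold comp
  rw [le_div_iff₀ hopt]
  rcases max_choice (I.η - I.ε) (I.γ - I.γ ^ 2 / I.α -
    (18 * I.α * d + 14 * I.η * predError e I.pred / I.γ) / (I.ε * optSeq d e)) with h | h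
  · rw [h]
    have h3 := failScale_mul_le hI hH
    have h4 : I.ε / 16 ≤ I.ε / 16 * optSeq d e := le_mul_of_one_le_right (by positivity) hO1
    unfold AdaInput.kept at hrob
    linarith
  · rw [h]
    have h3 := two_failScale_le hI
    have h4 := mul_le_mul_of_nonneg_right (sub_sq_div_le_kappa hI) hopt.le
    have h5 : (I.γ - I.γ ^ 2 / I.α -
        (18 * I.α * d + 14 * I.η * predError e I.pred / I.γ) / (I.ε * optSeq d e)) * optSeq d e =
        (I.γ - I.γ ^ 2 / I.α) * optSeq d e - (17 * I.α * d / I.ε + I.α * d / I.ε) -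
          I.price * predError e I.pred := by
      unfold AdaInput.price
      field_simp
      ring
    rw [h5]
    linarith

end ORRA

end

theorem mainTheorem8 :
    ∃ C : ℝ, 0 < C ∧
      ∀ (n d : ℕ) (η γ ε α : ℝ) (H : ℕ)
        (A : ORRA.Trajectory n → List (ORRA.Request n) → List (ORRA.Action n))
        (fallback : ORRA.Trajectory n → ORRA.Request n → ℕ → ORRA.Action n)
        (e pred : ℕ → ORRA.Request n),
        1 ≤ d →
        η ≤ ORRA.etaORRA →
        0 < γ → γ ≤ 1 →
        0 < ε → ε < η →
        3 ≤ α → η - 15 * ε / 16 ≤ γ * α / (α + γ) →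
        C * (η * α * d / ε ^ 2) ≤ (H : ℝ) →
        ORRA.IsOfflineOracle d γ A →
        ORRA.FiniteSupport e → ORRA.FiniteSupport pred →
        0 < ORRA.optSeq d e →
        max (η - ε)
            (γ - γ ^ 2 / α -
              (18 * α * d + 14 * η * ORRA.predError e pred / γ) / (ε * ORRA.optSeq d e))
          ≤ ORRA.comp d e (ORRA.adaSwitchORRA d η γ ε α H A fallback pred) := by
  refine ⟨100, by norm_num, ?_⟩
  intro n d η γ ε α H A fallback e pred hd hη hγ hγ1 hε hεη hα hratio hH hA he hp hopt
  have hH0 : 0 < H := by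
    have h1 : (0 : ℝ) < d := by exact_mod_cast hd
    have h2 : 0 < η := hε.trans hεη
    have h3 : 0 < α := by linarith
    have h4 : (0 : ℝ) < H := lt_of_lt_of_le (by positivity) hH
    exact_mod_cast h4
  exact ORRA.le_comp_adaSwitch (I := ⟨pred, A, fallback, H, η, γ, ε, α, 2, d⟩)
    ⟨hd, rfl, rfl, hη, hγ, hγ1, hε, hεη, hα, hratio, hH0, hA, hp⟩ hH he hopt
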